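/- Let $0<\alpha<1$, let $h>0$ and $t_n=nh$. For $f:(0,\infty)\times\mathbb R^d\to\mathbb R^d$ (any $d$) consider the following two implicit schemes for the Caputo fractional ODE ${}^C_0D^\alpha_t x(t)=f(t,x(t))$, $x(0)=x_0$. **Second order F-BDF.** Let $\left(\tfrac32-2\xi+\tfrac12\xi^2\right)^\alpha=\sum_{j\ge0}\mu_j\xi^j$ and $\delta_n=-\sum_{j=0}^{n-1}\mu_j$. The scheme is $$\sum_{j=1}^{n}\mu_{n-j}x_j+\delta_n x_0=h^\alpha f(t_n,x_n),\qquad n\ge1.$$ **Quadratic interpolation approximation (QIA, order $3-\alpha$).** For $n\ge2$ let $\Pi_n x$ be the function on $[0,n]$ which on $[k,k+1]$ is the quadratic interpolant of the values $x_k,x_{k+1},x_{k+2}$ at the nodes $k,k+1,k+2$ if $0\le k\le n-2$, and of $x_{n-2},x_{n-1},x_n$ at $n-2,n-1,n$ if $k=n-1$; let $\Pi_1x$ be the linear interpolant of $x_0,x_1$ on $[0,1]$. The weights $\mu_j^{(n)}$ are defined by $\frac1{\Gamma(1-\alpha)}\int_0^n (n-s)^{-\alpha}(\Pi_nx)'(s)\,ds=\sum_{j=0}^n\mu^{(n)}_{n-j}x_j$,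 and the scheme is $$\sum_{j=0}^{n}\mu^{(n)}_{n-j}x_j=h^\alpha f(t_n,x_n),\qquad n\ge1.$$ Then there is a constant $c_\alpha>0$, depending only on $\alpha$, such that the following holds. **(i) Contractivity.** Let $\lambda<0$, and suppose that $$h^\alpha\lambda\le-2\mu_2-2\mu_3\ \text{ (second order F-BDF)},\qquad\text{resp.}\qquad h^\alpha\lambda\le-2\mu^{(n)}_2\ \text{ for all } n\ge4\ \text{ (QIA)}.$$ Then the corresponding scheme is contractive: there are $C>0$ and $N\ge1$, depending only on $\alpha,h,\lambda$, such that for every $d$, every $f$ with $\langle f(t,u)-f(t,v),u-v\rangle\le\lambda\|u-v\|^2$ for all $t>0$ and $u,v\in\mathbb R^d$, and any two numerical solutions $(x_n)$, $(y_n)$, $$\|x_n-y_n\|^2\le\|x_0-y_0\|^2\,\frac{C}{n^\alpha}\quad(n\ge1),\qquad \|x_n-y_n\|^2\le\|x_0-y_0\|^2\,\frac{c_\alpha}{n^{\alpha}}\quad(n\ge N).$$ **(ii) Dissipativity.** Let $a\ge0$, $b>0$, and suppose that $$h^\alpha b\ge2\mu_2+2\mu_3\ \text{ (second order F-BDF)},\qquad\text{resp.}\qquad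 h^\alpha b\ge2\mu^{(n)}_2\ \text{ for all } n\ge4\ \text{ (QIA)}.$$ Then the corresponding scheme is dissipative: for every $d$, every $f$ with $\langle f(t,u),u\rangle\le a-b\|u\|^2$ for all $t>0$ and $u\in\mathbb R^d$, every $x_0\in\mathbb R^d$ and every $\varepsilon>0$ there is $n_0\ge1$ such that every numerical solution starting at $x_0$ satisfies $x_n\in B(0,r)$ for all $n\ge n_0$, where $r=\sqrt{c_\alpha a/b}+\varepsilon$. Moreover, if $a=0$, there are $C>0$ and $N\ge1$, depending only on $\alpha,h,b$, such that for every $d$ and every such $f$ all numerical solutions satisfy $\|x_n\|^2\le C\|x_0\|^2n^{-\alpha}$ for $n\ge1$ and $\|x_n\|^2\le c_\alpha\|x_0\|^2n^{-\alpha}$ for $n\ge N$. -/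

import Mathlib

noncomputable section

/-! ## Standing structure conditions on the right-hand side -/

/-- `⟨f(t,u) - f(t,v), u - v⟩ ≤ lam ‖u - v‖²` for all `t > 0` and all `u, v ∈ ℝᵈ`. -/
def OneSidedLipschitz {d : ℕ}
    (f : ℝ → EuclideanSpace ℝ (Fin d) → EuclideanSpace ℝ (Fin d)) (lam : ℝ) : Prop :=
  ∀ t : ℝ, 0 < t → ∀ u v : EuclideanSpace ℝ (Fin d),
    inner ℝ (f t u - f t v) (u - v) ≤ lam * ‖u - v‖ ^ 2

/-- `⟨f(t,u), u⟩ ≤ a - b ‖u‖²` for all `t > 0` and all `u ∈ ℝᵈ`. -/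
def DissipativeCondition {d : ℕ}
    (f : ℝ → EuclideanSpace ℝ (Fin d) → EuclideanSpace ℝ (Fin d)) (a b : ℝ) : Prop :=
  ∀ t : ℝ, 0 < t → ∀ u : EuclideanSpace ℝ (Fin d), inner ℝ (f t u) u ≤ a - b * ‖u‖ ^ 2

/-! ## Full-history schemes -/

/-- The sequence `x` solves the implicit scheme
`∑_{j=0}^n w n (n-j) x_j = h^α f(t_n, x_n)`, `n = 1, 2, …`, with `t_n = n h`.
Here `w n j` is the weight, at time level `n`, of the value `x_{n-j}`. -/
def IsSchemeSolution (w : ℕ → ℕ → ℝ) (α h : ℝ) {d : ℕ}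
    (f : ℝ → EuclideanSpace ℝ (Fin d) → EuclideanSpace ℝ (Fin d))
    (x : ℕ → EuclideanSpace ℝ (Fin d)) : Prop :=
  ∀ n : ℕ, 1 ≤ n →
    ∑ j ∈ Finset.range (n + 1), w n (n - j) • x j = h ^ α • f ((n : ℝ) * h) (x n)

/-! ## Second order fractional BDF -/

/-- Grünwald-Letnikov weights `(-1)^k (α choose k)`, the Taylor coefficients of `(1 - ξ)^α`. -/
def glWeight (α : ℝ) (k : ℕ) : ℝ := (-1) ^ k * Ring.choose α k

/-- The Taylor coefficients of `(3/2 - 2ξ + ξ²/2)^α = (3/2)^α (1 - ξ)^α (1 - ξ/3)^α`,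
written as a Cauchy product; see `hasSum_bdf2Weight`. -/
def bdf2Weight (α : ℝ) (j : ℕ) : ℝ :=
  (3 / 2 : ℝ) ^ α *
    ∑ l ∈ Finset.range (j + 1), (1 / 3 : ℝ) ^ l * glWeight α l * glWeight α (j - l)

/-- Generating function of the Grünwald-Letnikov weights. -/
theorem hasSum_glWeight (α ξ : ℝ) (hξ : |ξ| < 1) :
    HasSum (fun k => glWeight α k * ξ ^ k) ((1 - ξ) ^ α) := by
  have h := (Real.one_add_rpow_hasFPowerSeriesOnBall_zero (a := α)).hasSum (y := -ξ)
    (by simpa [Metric.mem_eball, edist_zero_right, enorm_eq_nnnorm, ← NNReal.coe_lt_coe] using hξ)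
  have e : (fun k => glWeight α k * ξ ^ k) =
      fun k => (binomialSeries ℝ α k) fun _ => -ξ := by
    funext k
    rw [binomialSeries_apply, glWeight]
    simp only [List.ofFn_const, List.prod_replicate, smul_eq_mul]
    rw [neg_pow ξ k]
    ring
  rw [e]
  simpa [sub_eq_add_neg] using h

/-- Generating function of the second order BDF weights. -/
theorem hasSum_bdf2Weight (α ξ : ℝ) (hξ : |ξ| < 1) :
    HasSum (fun j => bdf2Weight α j * ξ ^ j) ((3 / 2 - 2 * ξ + 1 / 2 * ξ ^ 2) ^ α) := by
  have hξ3 : |ξ / 3| < 1 := by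
    rw [abs_div, abs_of_pos (by norm_num : (0 : ℝ) < 3)]
    linarith
  have h1 := hasSum_glWeight α ξ hξ
  have h3 := hasSum_glWeight α (ξ / 3) hξ3
  have hp := hasSum_sum_range_mul_of_summable_norm h3.summable.norm h1.summable.norm
  rw [h1.tsum_eq, h3.tsum_eq] at hp
  have hlt := abs_lt.mp hξ
  have hval : (3 / 2 - 2 * ξ + 1 / 2 * ξ ^ 2) ^ α =
      (3 / 2 : ℝ) ^ α * ((1 - ξ / 3) ^ α * (1 - ξ) ^ α) := by
    rw [← Real.mul_rpow (by linarith) (by linarith),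
      ← Real.mul_rpow (by norm_num) (mul_nonneg (by linarith) (by linarith))]
    congr 1
    ring
  have e : (fun j => bdf2Weight α j * ξ ^ j) = fun j => (3 / 2 : ℝ) ^ α *
      ∑ l ∈ Finset.range (j + 1),
        glWeight α l * (ξ / 3) ^ l * (glWeight α (j - l) * ξ ^ (j - l)) := by
    funext j
    rw [bdf2Weight, mul_assoc, Finset.sum_mul]
    congr 1
    refine Finset.sum_congr rfl fun l hl => ?_
    have hlj : l ≤ j := Nat.lt_succ_iff.mp (Finset.mem_range.mp hl)
    have hpow : ξ ^ j = ξ ^ l * ξ ^ (j - l) := by rw [← pow_add, Nat.add_sub_cancel' hlj]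
    rw [hpow, div_pow, div_pow, one_pow]
    ring
  rw [hval, e]
  exact hp.mul_left _

/-- Weights at time level `n` of the second order F-BDF for the Caputo derivative:
`μ_j` multiplies `x_{n-j}` for `j < n`, and `δ_n = -∑_{j<n} μ_j` multiplies `x_0`. -/
def bdf2SchemeWeight (α : ℝ) (n j : ℕ) : ℝ :=
  if j < n then bdf2Weight α j else -∑ i ∈ Finset.range n, bdf2Weight α i

/-! ## Quadratic interpolation approximation -/

/-- Interpolation nodes (in units of the step size) used on `[k, k+1]`, `k < n`, at time level `n`:
`{k, k+1, k+2}` if `k + 2 ≤ n`; `{n-2, n-1, n}` on the last interval `k = n - 1` if `n ≥ 2`;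
and, when `n = 1`, the only two available nodes `{0, 1}`. -/
def qiaNodes (n k : ℕ) : Finset ℕ :=
  if n = 1 then {0, 1} else if k + 2 ≤ n then {k, k + 1, k + 2} else {n - 2, n - 1, n}

/-- Derivative at `s` of the Lagrange basis polynomial at node `i` of the interpolation
on `[k, k+1]` at time level `n` (zero if `i` is not one of the nodes). -/
def qiaBasisDeriv (n k i : ℕ) (s : ℝ) : ℝ :=
  if i ∈ qiaNodes n k then
    (Polynomial.derivative (Lagrange.basis (qiaNodes n k) (fun m : ℕ => (m : ℝ)) i)).eval s
  else 0

/-- The weight `μ_j^{(n)}` of `x_{n-j}`: the coefficient of `x_{n-j}` in the Caputo derivative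
`Γ(1-α)⁻¹ ∫_0^n (n-s)^{-α} Π'(s) ds` of the piecewise quadratic interpolant `Π` of
`x_0, …, x_n` (unit step size; for step size `h` the derivative acquires the factor `h^{-α}`). -/
def qiaWeight (α : ℝ) (n j : ℕ) : ℝ :=
  1 / Real.Gamma (1 - α) *
    ∑ k ∈ Finset.range n,
      ∫ s in (k : ℝ)..((k : ℝ) + 1), ((n : ℝ) - s) ^ (-α) * qiaBasisDeriv n k (n - j) s

/-! ## Contractivity and dissipativity of a scheme -/

/-- Contractivity with the rate `n^{-α}`: for all dimensions, all one-sided Lipschitz `f` and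
all pairs of numerical solutions, `‖x_n - y_n‖² ≤ C ‖x_0 - y_0‖² n^{-α}` for all `n ≥ 1`
with some `C` independent of `d`, `f` and the solutions, and with the prescribed
constant `c` in place of `C` for all large `n`. -/
def SchemeContractive (w : ℕ → ℕ → ℝ) (α c h lam : ℝ) : Prop :=
  ∃ C : ℝ, 0 < C ∧ ∃ N : ℕ, 1 ≤ N ∧
    ∀ (d : ℕ) (f : ℝ → EuclideanSpace ℝ (Fin d) → EuclideanSpace ℝ (Fin d)),
      OneSidedLipschitz f lam →
      ∀ x y : ℕ → EuclideanSpace ℝ (Fin d),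
        IsSchemeSolution w α h f x → IsSchemeSolution w α h f y →
        (∀ n : ℕ, 1 ≤ n → ‖x n - y n‖ ^ 2 ≤ ‖x 0 - y 0‖ ^ 2 * (C / (n : ℝ) ^ α)) ∧
        (∀ n : ℕ, N ≤ n → ‖x n - y n‖ ^ 2 ≤ ‖x 0 - y 0‖ ^ 2 * (c / (n : ℝ) ^ α))

/-- Dissipativity: for every initial value `x₀` and `ε > 0`, every numerical solution that
starts at `x₀` is eventually in the open ball `B(0, √(c a / b) + ε)`. -/
def SchemeDissipative (w : ℕ → ℕ → ℝ) (α c h a b : ℝ) : Prop :=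
  ∀ (d : ℕ) (f : ℝ → EuclideanSpace ℝ (Fin d) → EuclideanSpace ℝ (Fin d)),
    DissipativeCondition f a b →
    ∀ (x₀ : EuclideanSpace ℝ (Fin d)) (ε : ℝ), 0 < ε →
      ∃ n₀ : ℕ, 1 ≤ n₀ ∧ ∀ x : ℕ → EuclideanSpace ℝ (Fin d),
        IsSchemeSolution w α h f x → x 0 = x₀ →
        ∀ n : ℕ, n₀ ≤ n → x n ∈ Metric.ball 0 (Real.sqrt (c * a / b) + ε)

/-- Decay with the rate `n^{-α}` of all numerical solutions when the dissipative condition holds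
with `a = 0`, the constants being as in `SchemeContractive`. -/
def SchemeDecay (w : ℕ → ℕ → ℝ) (α c h b : ℝ) : Prop :=
  ∃ C : ℝ, 0 < C ∧ ∃ N : ℕ, 1 ≤ N ∧
    ∀ (d : ℕ) (f : ℝ → EuclideanSpace ℝ (Fin d) → EuclideanSpace ℝ (Fin d)),
      DissipativeCondition f 0 b →
      ∀ x : ℕ → EuclideanSpace ℝ (Fin d), IsSchemeSolution w α h f x →
        (∀ n : ℕ, 1 ≤ n → ‖x n‖ ^ 2 ≤ C * ‖x 0‖ ^ 2 * (n : ℝ) ^ (-α)) ∧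
        (∀ n : ℕ, N ≤ n → ‖x n‖ ^ 2 ≤ c * ‖x 0‖ ^ 2 * (n : ℝ) ^ (-α))

end

noncomputable section

/-! ## Sums of powers and a discrete comparison principle -/

lemma exists_sum_geometric_mul_sq_le {r : ℝ} (hr0 : 0 ≤ r) (hr1 : r < 1) :
    ∃ S : ℝ, 0 < S ∧ ∀ n : ℕ, ∑ l ∈ Finset.range n, r ^ l * ((l : ℝ) + 1) ^ 2 ≤ S := by
  have hn : ‖r‖ < 1 := by rwa [Real.norm_of_nonneg hr0]
  have h2 := summable_pow_mul_geometric_of_norm_lt_one 2 hn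
  have h1 := summable_pow_mul_geometric_of_norm_lt_one 1 hn
  have h0 := summable_pow_mul_geometric_of_norm_lt_one 0 hn
  have hs : Summable fun l : ℕ => r ^ l * ((l : ℝ) + 1) ^ 2 := by
    refine ((h2.add (h1.mul_left 2)).add h0).congr fun l => ?_
    ring
  have hnn : ∀ l : ℕ, 0 ≤ r ^ l * ((l : ℝ) + 1) ^ 2 := fun l => by positivity
  refine ⟨∑' l : ℕ, r ^ l * ((l : ℝ) + 1) ^ 2 + 1, ?_, fun n => ?_⟩
  · have h3 : 0 ≤ ∑' l : ℕ, r ^ l * ((l : ℝ) + 1) ^ 2 := tsum_nonneg hnn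
    linarith
  · have := hs.sum_le_tsum (Finset.range n) fun l _ => hnn l
    linarith

lemma exists_geometric_conv_rpow_le {r p : ℝ} (hr0 : 0 ≤ r) (hr1 : r < 1) (hp0 : 0 ≤ p)
    (hp2 : p ≤ 2) :
    ∃ S : ℝ, 0 < S ∧ ∀ n : ℕ,
      ∑ l ∈ Finset.range (n + 1), r ^ l * (((n - l : ℕ) : ℝ) + 1) ^ (-p) ≤
        S * ((n : ℝ) + 1) ^ (-p) := by
  obtain ⟨S, hS, hb⟩ := exists_sum_geometric_mul_sq_le hr0 hr1
  refine ⟨S, hS, fun n => ?_⟩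
  refine le_trans ?_ (mul_le_mul_of_nonneg_right (hb (n + 1)) (by positivity))
  rw [Finset.sum_mul]
  refine Finset.sum_le_sum fun l hl => ?_
  have hln : l ≤ n := Nat.lt_succ_iff.mp (Finset.mem_range.mp hl)
  rw [mul_assoc]
  refine mul_le_mul_of_nonneg_left ?_ (by positivity)
  have hl0 : (0 : ℝ) ≤ l := Nat.cast_nonneg l
  have hln' : (l : ℝ) ≤ n := Nat.cast_le.mpr hln
  rw [Nat.cast_sub hln]
  have hpos : (0 : ℝ) < (n : ℝ) - l + 1 := by linarith
  have hn1 : (0 : ℝ) < (n : ℝ) + 1 := by linarith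
  have hmul : (n : ℝ) + 1 ≤ ((l : ℝ) + 1) * ((n : ℝ) - l + 1) := by nlinarith
  calc ((n : ℝ) - l + 1) ^ (-p)
      ≤ (((n : ℝ) + 1) / ((l : ℝ) + 1)) ^ (-p) :=
        Real.rpow_le_rpow_of_nonpos (by positivity)
          (by rw [div_le_iff₀ (by positivity)]; linarith) (by linarith)
    _ = ((l : ℝ) + 1) ^ p * ((n : ℝ) + 1) ^ (-p) := by
        rw [Real.div_rpow hn1.le (by positivity), Real.rpow_neg (by positivity : (0:ℝ) ≤ (l:ℝ) + 1),
          div_inv_eq_mul, mul_comm]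
    _ ≤ ((l : ℝ) + 1) ^ 2 * ((n : ℝ) + 1) ^ (-p) := by
        refine mul_le_mul_of_nonneg_right ?_ (by positivity)
        rw [← Real.rpow_natCast]
        exact Real.rpow_le_rpow_of_exponent_le (by linarith) (by exact_mod_cast hp2)

lemma sum_rpow_neg_le {γ : ℝ} (hγ0 : 0 < γ) (hγ1 : γ < 1) (n : ℕ) :
    ∑ i ∈ Finset.range (n + 1), (i : ℝ) ^ (-γ) ≤ (n : ℝ) ^ (1 - γ) / (1 - γ) := by
  have h1γ : 0 < 1 - γ := by linarith
  induction n with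
  | zero =>
    simp [Real.zero_rpow (neg_ne_zero.mpr hγ0.ne'), Real.zero_rpow h1γ.ne']
  | succ n ih =>
    rw [Finset.sum_range_succ]
    have hn : (0 : ℝ) ≤ n := Nat.cast_nonneg n
    have hm : (0 : ℝ) < (n : ℝ) + 1 := by linarith
    have hb := rpow_one_add_le_one_add_mul_self (s := -1 / ((n : ℝ) + 1))
      (by rw [le_div_iff₀ hm]; linarith) h1γ.le (by linarith)
    have he : 1 + -1 / ((n : ℝ) + 1) = n / ((n : ℝ) + 1) := by field_simp; ring
    rw [he, Real.div_rpow hn hm.le, div_le_iff₀ (by positivity)] at hb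
    have hsplit : ((n : ℝ) + 1) ^ (1 - γ) = ((n : ℝ) + 1) * ((n : ℝ) + 1) ^ (-γ) := by
      rw [sub_eq_add_neg, Real.rpow_add hm, Real.rpow_one]
    push_cast
    have hkey : (n : ℝ) ^ (1 - γ) + (1 - γ) * ((n : ℝ) + 1) ^ (-γ) ≤ ((n : ℝ) + 1) ^ (1 - γ) := by
      have h2 : (1 + (1 - γ) * (-1 / ((n : ℝ) + 1))) * ((n : ℝ) + 1) ^ (1 - γ) =
          ((n : ℝ) + 1) ^ (1 - γ) - (1 - γ) * ((n : ℝ) + 1) ^ (-γ) := by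
        rw [hsplit]; field_simp; ring
      linarith
    rw [le_div_iff₀ h1γ] at ih ⊢
    nlinarith

/-- The kernel `ν`, a perturbation of a discrete fractional derivative, maps `n ^ (-γ)` to a
sequence that is eventually bounded below by a multiple of `n ^ (-γ)`. -/
lemma eventually_conv_rpow_ge {α γ β K : ℝ} {ν : ℕ → ℝ} (hα : 0 < α) (hγ0 : 0 < γ) (hγ1 : γ < 1)
    (hβ : 0 < β) (hν : ∀ j, 1 ≤ j → ν j ≤ 0)
    (hsum : ∀ n : ℕ, β ≤ ∑ j ∈ Finset.range (n + 1), ν j)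
    (hK : ∀ j : ℕ, |ν j| ≤ K * ((j : ℝ) + 1) ^ (-(1 + α))) :
    ∃ N : ℕ, 1 ≤ N ∧ ∀ n : ℕ, N ≤ n →
      β / 2 * (n : ℝ) ^ (-γ) ≤
        ∑ j ∈ Finset.range (n + 1), ν j * ((n - j : ℕ) : ℝ) ^ (-γ) := by
  have hν0 : β ≤ ν 0 := by simpa using hsum 0
  have hν0' : 0 < ν 0 := hβ.trans_le hν0
  have hK0 : 0 ≤ K := by simpa using (abs_nonneg _).trans (hK 0)
  have h1γ : 0 < 1 - γ := by linarith
  set ε : ℝ := β / (4 * ν 0) with hε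
  have hε0 : 0 < ε := by positivity
  set δ : ℝ := ε / (1 + ε) with hδ
  have hδ0 : 0 < δ := by positivity
  set C : ℝ := K * δ ^ (-(1 + α)) with hC
  have hC0 : 0 ≤ C := by positivity
  have hlim : Filter.Tendsto (fun n : ℕ => C / (1 - γ) * (n : ℝ) ^ (-α)) Filter.atTop
      (nhds 0) := by
    simpa using ((tendsto_rpow_neg_atTop hα).comp tendsto_natCast_atTop_atTop).const_mul
      (C / (1 - γ))
  obtain ⟨N, hN⟩ := Filter.eventually_atTop.mp
    (hlim.eventually (gt_mem_nhds (show 0 < β / 4 by positivity)))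
  refine ⟨max N 1, le_max_right _ _, fun n hn => ?_⟩
  have hn1 : 1 ≤ n := (le_max_right _ _).trans hn
  have hnN := hN n ((le_max_left _ _).trans hn)
  have hnR : (0 : ℝ) < n := by exact_mod_cast hn1
  have hterm : ∀ j ∈ Finset.range n, -ν (j + 1) * ((n - (j + 1) : ℕ) : ℝ) ^ (-γ) ≤
      -ν (j + 1) * ((1 + ε) * (n : ℝ) ^ (-γ)) +
        C * (n : ℝ) ^ (-(1 + α)) * ((n - (j + 1) : ℕ) : ℝ) ^ (-γ) := by
    intro j hj
    have hjn : j + 1 ≤ n := Finset.mem_range.mp hj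
    have ha : 0 ≤ -ν (j + 1) := by linarith [hν (j + 1) (by omega)]
    have hpn : 0 ≤ ((n - (j + 1) : ℕ) : ℝ) ^ (-γ) := by positivity
    by_cases hcase : (n : ℝ) ≤ (1 + ε) * ((n - (j + 1) : ℕ) : ℝ)
    · have hq : ((n - (j + 1) : ℕ) : ℝ) ^ (-γ) ≤ (1 + ε) * (n : ℝ) ^ (-γ) := by
        calc ((n - (j + 1) : ℕ) : ℝ) ^ (-γ) ≤ ((n : ℝ) / (1 + ε)) ^ (-γ) :=
              Real.rpow_le_rpow_of_nonpos (by positivity)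
                (by rw [div_le_iff₀ (by positivity)]; linarith) (by linarith)
          _ = (1 + ε) ^ γ * (n : ℝ) ^ (-γ) := by
              rw [Real.div_rpow hnR.le (by positivity),
                Real.rpow_neg (by positivity : (0 : ℝ) ≤ 1 + ε), div_inv_eq_mul, mul_comm]
          _ ≤ (1 + ε) * (n : ℝ) ^ (-γ) := by
              refine mul_le_mul_of_nonneg_right ?_ (by positivity)
              simpa using Real.rpow_le_rpow_of_exponent_le (by linarith : 1 ≤ 1 + ε) hγ1.le
      have := mul_le_mul_of_nonneg_left hq ha
      have h3 : 0 ≤ C * (n : ℝ) ^ (-(1 + α)) * ((n - (j + 1) : ℕ) : ℝ) ^ (-γ) := by positivity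
      linarith
    · push Not at hcase
      rw [Nat.cast_sub hjn] at hcase
      have hjδ : δ * n ≤ ((j + 1 : ℕ) : ℝ) := by
        rw [hδ, div_mul_eq_mul_div, div_le_iff₀ (by positivity)]
        nlinarith
      have hb : -ν (j + 1) ≤ C * (n : ℝ) ^ (-(1 + α)) := by
        calc -ν (j + 1) ≤ |ν (j + 1)| := neg_le_abs _
          _ ≤ K * (((j + 1 : ℕ) : ℝ) + 1) ^ (-(1 + α)) := hK _
          _ ≤ K * (δ * n) ^ (-(1 + α)) := by
              refine mul_le_mul_of_nonneg_left ?_ hK0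
              exact Real.rpow_le_rpow_of_nonpos (by positivity) (by linarith) (by linarith)
          _ = C * (n : ℝ) ^ (-(1 + α)) := by
              rw [Real.mul_rpow hδ0.le hnR.le, hC, mul_assoc]
      have := mul_le_mul_of_nonneg_right hb hpn
      have h3 : 0 ≤ -ν (j + 1) * ((1 + ε) * (n : ℝ) ^ (-γ)) := by positivity
      linarith
  have hS := Finset.sum_le_sum hterm
  rw [Finset.sum_add_distrib, ← Finset.sum_mul, ← Finset.mul_sum] at hS
  have hA : ∑ j ∈ Finset.range n, -ν (j + 1) ≤ ν 0 - β := by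
    have := hsum n
    rw [Finset.sum_range_succ'] at this
    rw [Finset.sum_neg_distrib]
    linarith
  have hB : ∑ j ∈ Finset.range n, ((n - (j + 1) : ℕ) : ℝ) ^ (-γ) ≤
      (n : ℝ) ^ (1 - γ) / (1 - γ) := by
    have hr := Finset.sum_range_reflect (fun i : ℕ => (i : ℝ) ^ (-γ)) n
    have he : ∑ j ∈ Finset.range n, ((n - (j + 1) : ℕ) : ℝ) ^ (-γ) =
        ∑ j ∈ Finset.range n, (j : ℝ) ^ (-γ) := by
      rw [← hr]
      refine Finset.sum_congr rfl fun j _ => ?_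
      rw [Nat.sub_sub, add_comm 1 j]
    rw [he]
    refine le_trans ?_ (sum_rpow_neg_le hγ0 hγ1 n)
    rw [Finset.sum_range_succ]
    have : 0 ≤ (n : ℝ) ^ (-γ) := by positivity
    linarith
  have hB' : C * (n : ℝ) ^ (-(1 + α)) *
      ∑ j ∈ Finset.range n, ((n - (j + 1) : ℕ) : ℝ) ^ (-γ) ≤ β / 4 * (n : ℝ) ^ (-γ) := by
    calc _ ≤ C * (n : ℝ) ^ (-(1 + α)) * ((n : ℝ) ^ (1 - γ) / (1 - γ)) :=
          mul_le_mul_of_nonneg_left hB (by positivity)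
      _ = C / (1 - γ) * (n : ℝ) ^ (-α) * (n : ℝ) ^ (-γ) := by
          have : (n : ℝ) ^ (-(1 + α)) * (n : ℝ) ^ (1 - γ) = (n : ℝ) ^ (-α) * (n : ℝ) ^ (-γ) := by
            rw [← Real.rpow_add hnR, ← Real.rpow_add hnR]
            congr 1; ring
          calc _ = C / (1 - γ) * ((n : ℝ) ^ (-(1 + α)) * (n : ℝ) ^ (1 - γ)) := by ring
            _ = _ := by rw [this]; ring
      _ ≤ _ := mul_le_mul_of_nonneg_right hnN.le (by positivity)
  have hA' : (∑ j ∈ Finset.range n, -ν (j + 1)) * ((1 + ε) * (n : ℝ) ^ (-γ)) ≤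
      (ν 0 - 3 * β / 4) * (n : ℝ) ^ (-γ) := by
    calc _ ≤ (ν 0 - β) * ((1 + ε) * (n : ℝ) ^ (-γ)) :=
          mul_le_mul_of_nonneg_right hA (by positivity)
      _ = ((ν 0 - β) * (1 + ε)) * (n : ℝ) ^ (-γ) := by ring
      _ ≤ _ := by
          refine mul_le_mul_of_nonneg_right ?_ (by positivity)
          have h4 : ν 0 * ε = β / 4 := by rw [hε]; field_simp
          nlinarith
  rw [Finset.sum_range_succ']
  have hneg : ∑ j ∈ Finset.range n, -ν (j + 1) * ((n - (j + 1) : ℕ) : ℝ) ^ (-γ) =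
      -∑ j ∈ Finset.range n, ν (j + 1) * ((n - (j + 1) : ℕ) : ℝ) ^ (-γ) := by
    rw [← Finset.sum_neg_distrib]
    exact Finset.sum_congr rfl fun j _ => by ring
  rw [hneg] at hS
  simp only [Nat.sub_zero]
  linarith

/-- Discrete comparison principle. -/
lemma exists_comparison_const {α γ β K : ℝ} {ν : ℕ → ℝ} (hα : 0 < α) (hγ0 : 0 < γ) (hγ1 : γ < 1)
    (hβ : 0 < β) (hν : ∀ j, 1 ≤ j → ν j ≤ 0)
    (hsum : ∀ n : ℕ, β ≤ ∑ j ∈ Finset.range (n + 1), ν j)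
    (hK : ∀ j : ℕ, |ν j| ≤ K * ((j : ℝ) + 1) ^ (-(1 + α))) :
    ∃ G : ℝ, 0 < G ∧ ∀ (E : ℕ → ℝ) (A M : ℝ), 0 ≤ A → 0 ≤ M → E 0 = 0 → E 1 ≤ A / β + M →
      (∀ n : ℕ, 2 ≤ n →
        ∑ j ∈ Finset.range (n + 1), ν j * E (n - j) ≤ A + M * (n : ℝ) ^ (-γ)) →
      ∀ n : ℕ, 1 ≤ n → E n ≤ A / β + G * M * (n : ℝ) ^ (-γ) := by
  obtain ⟨N, hN1, hN⟩ := eventually_conv_rpow_ge hα hγ0 hγ1 hβ hν hsum hK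
  have hν0 : β ≤ ν 0 := by simpa using hsum 0
  have hν0' : 0 < ν 0 := hβ.trans_le hν0
  have hNR : (0 : ℝ) < N := by exact_mod_cast hN1
  have hstep : ∀ (E φ : ℕ → ℝ) (n : ℕ), (∀ m, m < n → E m ≤ φ m) →
      ∑ j ∈ Finset.range (n + 1), ν j * E (n - j) ≤
        ∑ j ∈ Finset.range (n + 1), ν j * φ (n - j) → E n ≤ φ n := by
    intro E φ n hlt hle
    rw [Finset.sum_range_succ', Finset.sum_range_succ'] at hle
    have h1 : ∑ j ∈ Finset.range n, ν (j + 1) * φ (n - (j + 1)) ≤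
        ∑ j ∈ Finset.range n, ν (j + 1) * E (n - (j + 1)) := by
      refine Finset.sum_le_sum fun j hj => ?_
      have hjn : j < n := Finset.mem_range.mp hj
      exact mul_le_mul_of_nonpos_left (hlt _ (by omega)) (hν _ (by omega))
    simp only [Nat.sub_zero] at hle
    have h2 : ν 0 * E n ≤ ν 0 * φ n := by linarith
    exact le_of_mul_le_mul_left h2 hν0'
  refine ⟨2 / β + (1 + 1 / β) * (N : ℝ) ^ γ, by positivity, ?_⟩
  intro E A M hA hM hE0 hE1 hE
  set G : ℝ := 2 / β + (1 + 1 / β) * (N : ℝ) ^ γ with hG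
  have hcrude : ∀ n : ℕ, E n ≤ A / β + M * (1 + 1 / β) := by
    intro n
    induction n using Nat.strong_induction_on with
    | _ n ih =>
      rcases Nat.lt_or_ge n 2 with h | h
      · interval_cases n
        · rw [hE0]; positivity
        · refine hE1.trans ?_
          have : 0 ≤ M * (1 / β) := by positivity
          linarith
      · refine hstep E (fun _ => A / β + M * (1 + 1 / β)) n ih ((hE n h).trans ?_)
        rw [← Finset.sum_mul]
        refine le_trans ?_ (mul_le_mul_of_nonneg_right (hsum n) (by positivity))
        have h1 : (n : ℝ) ^ (-γ) ≤ 1 :=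
          Real.rpow_le_one_of_one_le_of_nonpos (by exact_mod_cast (by omega : 1 ≤ n))
            (by linarith)
        have h2 : β * (A / β + M * (1 + 1 / β)) = A + M * β + M := by field_simp; ring
        rw [h2]
        have h3 : 0 ≤ M * β := by positivity
        nlinarith
  set φ : ℕ → ℝ := fun n => A / β + G * M * (n : ℝ) ^ (-γ) with hφ
  have hmain : ∀ n : ℕ, E n ≤ φ n := by
    intro n
    induction n using Nat.strong_induction_on with
    | _ n ih =>
      rcases Nat.eq_zero_or_pos n with h0 | hpos
      · subst h0
        rw [hE0, hφ]
        positivity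
      rcases Nat.lt_or_ge n (max N 2) with h | h
      · rcases Nat.lt_or_ge n N with h | h'
        · refine (hcrude n).trans ?_
          have hnR : (0 : ℝ) < n := by exact_mod_cast hpos
          have h1 : (1 : ℝ) ≤ (N : ℝ) ^ γ * (n : ℝ) ^ (-γ) := by
            rw [Real.rpow_neg hnR.le, ← div_eq_mul_inv, one_le_div (by positivity)]
            exact Real.rpow_le_rpow hnR.le (by exact_mod_cast h.le) hγ0.le
          have h2 : 0 ≤ 2 / β * M * (n : ℝ) ^ (-γ) := by positivity
          have h3 : 0 ≤ (1 + 1 / β) * M := by positivity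
          have h4 := mul_le_mul_of_nonneg_left h1 h3
          simp only [hφ, hG]
          nlinarith
        · have hn1 : n = 1 := by
            rcases lt_max_iff.mp h with h | h <;> omega
          subst hn1
          refine hE1.trans ?_
          have hN' : N = 1 := by omega
          simp only [hφ, hG, hN', Nat.cast_one, Real.one_rpow, mul_one]
          have : 0 ≤ (2 / β + 1 / β) * M := by positivity
          nlinarith
      · have hnN : N ≤ n := (le_max_left _ _).trans h
        refine hstep E φ n ih ((hE n ((le_max_right _ _).trans h)).trans ?_)
        have h1 : ∑ j ∈ Finset.range (n + 1), ν j * φ (n - j) =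
            A / β * ∑ j ∈ Finset.range (n + 1), ν j +
              G * M * ∑ j ∈ Finset.range (n + 1), ν j * ((n - j : ℕ) : ℝ) ^ (-γ) := by
          rw [Finset.mul_sum, Finset.mul_sum, ← Finset.sum_add_distrib]
          exact Finset.sum_congr rfl fun j _ => by simp only [hφ]; ring
        rw [h1]
        have hG0 : 0 ≤ G := by positivity
        have h2 : A ≤ A / β * ∑ j ∈ Finset.range (n + 1), ν j := by
          calc A = A / β * β := by field_simp
            _ ≤ _ := mul_le_mul_of_nonneg_left (hsum n) (by positivity)
        have h3 := mul_le_mul_of_nonneg_left (hN n hnN) (by positivity : 0 ≤ G * M)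
        have h4 : M * (n : ℝ) ^ (-γ) ≤ G * M * (β / 2 * (n : ℝ) ^ (-γ)) := by
          have h5 : 1 ≤ G * (β / 2) := by
            have h6 : 2 / β * (β / 2) = 1 := by field_simp
            have h7 : 0 ≤ (1 + 1 / β) * (N : ℝ) ^ γ * (β / 2) := by positivity
            rw [hG, add_mul, h6]
            linarith
          have h8 : 0 ≤ M * (n : ℝ) ^ (-γ) := by positivity
          nlinarith
        linarith
  exact fun n _ => hmain n

/-! ## Quadratic lower bounds and the energy estimate -/

/-- The quadratic form `2 ⟨X_n, ∑_j ω_j X_{n-j}⟩` is bounded below by a convolution of `η` with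
the squared norms, up to squared norms of the last two increments. -/
def QuadraticLowerBound (ω η : ℕ → ℝ) (k₀ k₁ : ℝ) : Prop :=
  ∀ (d : ℕ) (X : ℕ → EuclideanSpace ℝ (Fin d)) (n : ℕ), 2 ≤ n →
    ∑ j ∈ Finset.range (n + 1), η j * ‖X (n - j)‖ ^ 2 + k₀ * ‖X n - X (n - 1)‖ ^ 2
        - k₁ * ‖X (n - 1) - X (n - 2)‖ ^ 2 ≤
      2 * ∑ j ∈ Finset.range (n + 1), ω j * inner ℝ (X n) (X (n - j))

lemma two_mul_inner_eq {V : Type*} [NormedAddCommGroup V] [InnerProductSpace ℝ V] (x y : V) :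
    2 * inner ℝ x y = ‖x‖ ^ 2 + ‖y‖ ^ 2 - ‖x - y‖ ^ 2 := by
  rw [norm_sub_sq_real]; ring

lemma abs_two_mul_inner_le {V : Type*} [NormedAddCommGroup V] [InnerProductSpace ℝ V] (x y : V)
    {t : ℝ} (ht : 0 < t) : |2 * inner ℝ x y| ≤ ‖x‖ ^ 2 / t + t * ‖y‖ ^ 2 := by
  rw [abs_mul, abs_two]
  have h := abs_real_inner_le_norm x y
  have h2 : 0 ≤ (‖x‖ - t * ‖y‖) ^ 2 / t := by positivity
  have h3 : (‖x‖ - t * ‖y‖) ^ 2 / t = ‖x‖ ^ 2 / t + t * ‖y‖ ^ 2 - 2 * (‖x‖ * ‖y‖) := by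
    field_simp; ring
  linarith

lemma norm_sub_sq_le_two_mul {V : Type*} [NormedAddCommGroup V] (x y z : V) :
    ‖x - z‖ ^ 2 ≤ 2 * ‖x - y‖ ^ 2 + 2 * ‖y - z‖ ^ 2 := by
  have h := norm_sub_le_norm_sub_add_norm_sub x y z
  have h0 := norm_nonneg (x - z)
  nlinarith [sq_nonneg (‖x - y‖ - ‖y - z‖)]

lemma quadraticLowerBound_self {ω : ℕ → ℝ} (h3 : ∀ j, 3 ≤ j → ω j ≤ 0)
    (hsum : ∀ n, 2 ≤ n → 0 ≤ ∑ j ∈ Finset.range (n + 1), ω j) :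
    QuadraticLowerBound ω ω (-ω 1 - 2 * max (ω 2) 0) (2 * max (ω 2) 0) := by
  intro d X n hn
  obtain ⟨m, rfl⟩ : ∃ m, n = m + 2 := ⟨n - 2, by omega⟩
  have hs := mul_nonneg (hsum (m + 2) hn) (sq_nonneg ‖X (m + 2)‖)
  simp only [Finset.sum_range_succ', Nat.sub_zero, Nat.add_sub_cancel,
    show m + 2 - 1 = m + 1 by omega, show 0 + 1 = 1 from rfl, show 1 + 1 = 2 from rfl,
    show ∀ k, k + 1 + 1 + 1 = k + 3 from fun k => rfl] at hs ⊢
  have hrest : ∑ k ∈ Finset.range m, ω (k + 3) * ‖X (m + 2)‖ ^ 2 +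
      ∑ k ∈ Finset.range m, ω (k + 3) * ‖X (m + 2 - (k + 3))‖ ^ 2 ≤
      2 * ∑ k ∈ Finset.range m, ω (k + 3) * inner ℝ (X (m + 2)) (X (m + 2 - (k + 3))) := by
    rw [← Finset.sum_add_distrib, Finset.mul_sum]
    refine Finset.sum_le_sum fun k _ => ?_
    have hk := h3 (k + 3) (by omega)
    have e := two_mul_inner_eq (X (m + 2)) (X (m + 2 - (k + 3)))
    nlinarith [mul_nonneg (neg_nonneg.mpr hk) (sq_nonneg ‖X (m + 2) - X (m + 2 - (k + 3))‖)]
  have e1 := two_mul_inner_eq (X (m + 2)) (X (m + 1))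
  have e2 := two_mul_inner_eq (X (m + 2)) (X m)
  have e0 : inner ℝ (X (m + 2)) (X (m + 2)) = ‖X (m + 2)‖ ^ 2 := real_inner_self_eq_norm_sq _
  have hp : ω 2 * ‖X (m + 2) - X m‖ ^ 2 ≤ max (ω 2) 0 *
      (2 * ‖X (m + 2) - X (m + 1)‖ ^ 2 + 2 * ‖X (m + 1) - X m‖ ^ 2) :=
    (mul_le_mul_of_nonneg_right (le_max_left _ _) (sq_nonneg _)).trans
      (mul_le_mul_of_nonneg_left (norm_sub_sq_le_two_mul _ _ _) (le_max_right _ _))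
  rw [← Finset.sum_mul] at hrest
  have f1 : 2 * (ω 1 * inner ℝ (X (m + 2)) (X (m + 1))) = ω 1 * (‖X (m + 2)‖ ^ 2 +
      ‖X (m + 1)‖ ^ 2 - ‖X (m + 2) - X (m + 1)‖ ^ 2) := by rw [← e1]; ring
  have f2 : 2 * (ω 2 * inner ℝ (X (m + 2)) (X m)) = ω 2 * (‖X (m + 2)‖ ^ 2 +
      ‖X m‖ ^ 2 - ‖X (m + 2) - X m‖ ^ 2) := by rw [← e2]; ring
  rw [e0]
  linarith

/-- The kernel obtained from `ω` by moving a positive weight `ω 2` to the index `1`. -/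
def shiftedKernel (ω : ℕ → ℝ) (τ : ℝ) (j : ℕ) : ℝ :=
  if j = 0 then ω 0 - ω 2 / τ - 2 * max (ω 3) 0
  else if j = 1 then ω 1 + ω 2 else if j = 2 then 0 else -|ω j|

lemma quadraticLowerBound_shifted {ω : ℕ → ℝ} {τ : ℝ} (hτ : 0 < τ) (h2 : 0 ≤ ω 2)
    (h4 : ∀ j, 4 ≤ j → ω j ≤ 0)
    (hsum : ∀ n, 2 ≤ n → 0 ≤ ∑ j ∈ Finset.range (n + 1), ω j) :
    QuadraticLowerBound ω (shiftedKernel ω τ) (-ω 1 - ω 2) (ω 2 * τ) := by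
  intro d X n hn
  obtain ⟨m, rfl⟩ : ∃ m, n = m + 2 := ⟨n - 2, by omega⟩
  have hs := mul_nonneg (hsum (m + 2) hn) (sq_nonneg ‖X (m + 2)‖)
  simp only [Finset.sum_range_succ', Nat.sub_zero, Nat.add_sub_cancel,
    show m + 2 - 1 = m + 1 by omega, show 0 + 1 = 1 from rfl, show 1 + 1 = 2 from rfl,
    show ∀ k, k + 1 + 1 + 1 = k + 3 from fun k => rfl] at hs ⊢
  have s0 : shiftedKernel ω τ 0 = ω 0 - ω 2 / τ - 2 * max (ω 3) 0 := by simp [shiftedKernel]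
  have s1 : shiftedKernel ω τ 1 = ω 1 + ω 2 := by simp [shiftedKernel]
  have s2 : shiftedKernel ω τ 2 = 0 := by simp [shiftedKernel]
  have s3 : ∀ k, shiftedKernel ω τ (k + 3) = -|ω (k + 3)| := by simp [shiftedKernel]
  simp only [s0, s1, s2, s3]
  have hrest : ∑ k ∈ Finset.range m, ω (k + 3) * ‖X (m + 2)‖ ^ 2 +
      ∑ k ∈ Finset.range m, -|ω (k + 3)| * ‖X (m + 2 - (k + 3))‖ ^ 2 -
      ∑ k ∈ Finset.range m, (if k = 0 then 2 * max (ω 3) 0 * ‖X (m + 2)‖ ^ 2 else 0) ≤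
      2 * ∑ k ∈ Finset.range m, ω (k + 3) * inner ℝ (X (m + 2)) (X (m + 2 - (k + 3))) := by
    rw [← Finset.sum_add_distrib, ← Finset.sum_sub_distrib, Finset.mul_sum]
    refine Finset.sum_le_sum fun k _ => ?_
    have ha := abs_two_mul_inner_le (X (m + 2)) (X (m + 2 - (k + 3))) one_pos
    simp only [div_one, one_mul] at ha
    have hb : -(|ω (k + 3)| * (‖X (m + 2)‖ ^ 2 + ‖X (m + 2 - (k + 3))‖ ^ 2)) ≤
        ω (k + 3) * (2 * inner ℝ (X (m + 2)) (X (m + 2 - (k + 3)))) := by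
      have h5 := mul_le_mul_of_nonneg_left ha (abs_nonneg (ω (k + 3)))
      rw [← abs_mul] at h5
      linarith [neg_abs_le (ω (k + 3) * (2 * inner ℝ (X (m + 2)) (X (m + 2 - (k + 3)))))]
    have hc : ω (k + 3) * ‖X (m + 2)‖ ^ 2 -
        (if k = 0 then 2 * max (ω 3) 0 * ‖X (m + 2)‖ ^ 2 else 0) ≤
        -|ω (k + 3)| * ‖X (m + 2)‖ ^ 2 := by
      split_ifs with hk
      · subst hk
        rcases le_total (ω 3) 0 with h | h
        · simp [h, abs_of_nonpos h]
        · simp only [zero_add, max_eq_left h, abs_of_nonneg h]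
          linarith
      · rw [abs_of_nonpos (h4 (k + 3) (by omega))]
        linarith
    linarith
  have hite : ∑ k ∈ Finset.range m,
      (if k = 0 then 2 * max (ω 3) 0 * ‖X (m + 2)‖ ^ 2 else 0) ≤
        2 * max (ω 3) 0 * ‖X (m + 2)‖ ^ 2 := by
    have : 0 ≤ 2 * max (ω 3) 0 * ‖X (m + 2)‖ ^ 2 := by positivity
    rw [Finset.sum_ite_eq']
    split_ifs <;> linarith
  have e1 := two_mul_inner_eq (X (m + 2)) (X (m + 1))
  have e0 : inner ℝ (X (m + 2)) (X (m + 2)) = ‖X (m + 2)‖ ^ 2 := real_inner_self_eq_norm_sq _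
  have e2 := (abs_le.mp (abs_two_mul_inner_le (X (m + 2)) (X (m + 1) - X m) hτ)).2
  rw [inner_sub_right] at e2
  rw [← Finset.sum_mul] at hrest
  have f1 : 2 * (ω 1 * inner ℝ (X (m + 2)) (X (m + 1))) = ω 1 * (‖X (m + 2)‖ ^ 2 +
      ‖X (m + 1)‖ ^ 2 - ‖X (m + 2) - X (m + 1)‖ ^ 2) := by rw [← e1]; ring
  have f2 : ω 2 * (‖X (m + 2)‖ ^ 2 + ‖X (m + 1)‖ ^ 2 - ‖X (m + 2) - X (m + 1)‖ ^ 2 -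
      (‖X (m + 2)‖ ^ 2 / τ + τ * ‖X (m + 1) - X m‖ ^ 2)) ≤
      2 * (ω 2 * inner ℝ (X (m + 2)) (X m)) := by
    have := mul_le_mul_of_nonneg_left e2 h2
    have h6 : ω 2 * (2 * inner ℝ (X (m + 2)) (X (m + 1))) = ω 2 * (‖X (m + 2)‖ ^ 2 +
      ‖X (m + 1)‖ ^ 2 - ‖X (m + 2) - X (m + 1)‖ ^ 2) := by rw [e1]
    linarith
  rw [e0]
  have h7 : ω 2 / τ * ‖X (m + 2)‖ ^ 2 = ω 2 * (‖X (m + 2)‖ ^ 2 / τ) := by ring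
  linarith

/-- Energy `‖X_n‖² - r ‖X_{n-1}‖² + κ ‖X_n - X_{n-1}‖²`, set to `0` at `n = 0`. -/
def schemeEnergy {d : ℕ} (r κ : ℝ) (X : ℕ → EuclideanSpace ℝ (Fin d)) (n : ℕ) : ℝ :=
  if n = 0 then 0 else ‖X n‖ ^ 2 - r * ‖X (n - 1)‖ ^ 2 + κ * ‖X n - X (n - 1)‖ ^ 2

lemma conv_schemeEnergy_le {ω η ν : ℕ → ℝ} {k₀ k₁ r κ B : ℝ} (hQ : QuadraticLowerBound ω η k₀ k₁)
    (hκ : 0 ≤ κ) (hν0 : ν 0 = η 0 + B) (hνs : ∀ j, ν (j + 1) = η (j + 1) + r * ν j)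
    (hν : ∀ j, 1 ≤ j → ν j ≤ 0) (hk₀ : κ * ν 0 ≤ k₀) (hk₁ : k₁ ≤ -(κ * ν 1))
    {d : ℕ} (X : ℕ → EuclideanSpace ℝ (Fin d)) (hX : X 0 = 0) (n : ℕ) (hn : 2 ≤ n) :
    ∑ j ∈ Finset.range (n + 1), ν j * schemeEnergy r κ X (n - j) ≤
      B * ‖X n‖ ^ 2 + 2 * ∑ j ∈ Finset.range (n + 1), ω j * inner ℝ (X n) (X (n - j)) := by
  have h := hQ d X n hn
  have hE : ∑ j ∈ Finset.range (n + 1), ν j * schemeEnergy r κ X (n - j) =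
      ∑ j ∈ Finset.range n, ν j * ‖X (n - j)‖ ^ 2 -
        ∑ j ∈ Finset.range n, r * ν j * ‖X (n - (j + 1))‖ ^ 2 +
        κ * ∑ j ∈ Finset.range n, ν j * ‖X (n - j) - X (n - j - 1)‖ ^ 2 := by
    rw [Finset.sum_range_succ, Finset.mul_sum, ← Finset.sum_sub_distrib, ← Finset.sum_add_distrib]
    rw [Nat.sub_self, schemeEnergy, if_pos rfl, mul_zero, add_zero]
    refine Finset.sum_congr rfl fun j hj => ?_
    have hjn : j < n := Finset.mem_range.mp hj
    rw [schemeEnergy, if_neg (by omega), show n - (j + 1) = n - j - 1 by omega]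
    ring
  have hS1 : ∑ j ∈ Finset.range n, ν j * ‖X (n - j)‖ ^ 2 =
      ∑ j ∈ Finset.range n, ν (j + 1) * ‖X (n - (j + 1))‖ ^ 2 + ν 0 * ‖X n‖ ^ 2 := by
    have := Finset.sum_range_succ' (fun j => ν j * ‖X (n - j)‖ ^ 2) n
    rw [Finset.sum_range_succ] at this
    simpa [hX] using this
  have hη : ∑ j ∈ Finset.range (n + 1), η j * ‖X (n - j)‖ ^ 2 + B * ‖X n‖ ^ 2 =
      ∑ j ∈ Finset.range n, ν j * ‖X (n - j)‖ ^ 2 -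
        ∑ j ∈ Finset.range n, r * ν j * ‖X (n - (j + 1))‖ ^ 2 := by
    rw [hS1, Finset.sum_range_succ', add_sub_right_comm, ← Finset.sum_sub_distrib, hν0]
    simp only [Nat.sub_zero]
    have : ∀ j, ν (j + 1) * ‖X (n - (j + 1))‖ ^ 2 - r * ν j * ‖X (n - (j + 1))‖ ^ 2 =
        η (j + 1) * ‖X (n - (j + 1))‖ ^ 2 := fun j => by rw [hνs]; ring
    simp only [this]
    ring
  have hD : ∑ j ∈ Finset.range n, ν j * ‖X (n - j) - X (n - j - 1)‖ ^ 2 ≤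
      ν 0 * ‖X n - X (n - 1)‖ ^ 2 + ν 1 * ‖X (n - 1) - X (n - 2)‖ ^ 2 := by
    obtain ⟨m, rfl⟩ : ∃ m, n = m + 2 := ⟨n - 2, by omega⟩
    rw [Finset.sum_range_succ', Finset.sum_range_succ']
    have hneg : ∑ k ∈ Finset.range m, ν (k + 1 + 1) *
        ‖X (m + 2 - (k + 1 + 1)) - X (m + 2 - (k + 1 + 1) - 1)‖ ^ 2 ≤ 0 :=
      Finset.sum_nonpos fun k _ => mul_nonpos_of_nonpos_of_nonneg (hν _ (by omega)) (sq_nonneg _)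
    simp only [zero_add, Nat.sub_zero, show m + 2 - 1 - 1 = m + 2 - 2 by omega]
    linarith
  have hD' := mul_le_mul_of_nonneg_left hD hκ
  have h8 := mul_le_mul_of_nonneg_right hk₀ (sq_nonneg ‖X n - X (n - 1)‖)
  have h9 := mul_le_mul_of_nonneg_right hk₁ (sq_nonneg ‖X (n - 1) - X (n - 2)‖)
  rw [hE]
  linarith

/-! ## Decay of the solutions of a forced scheme -/

/-- A bound for all sequences satisfying a scheme whose right-hand side is dissipative along the
sequence: they decay like `n ^ (-γ)` for some `γ > α` towards a ball of squared radius `c a / b`. -/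
def ForcedDecay (w : ℕ → ℕ → ℝ) (α c H b : ℝ) : Prop :=
  ∃ γ : ℝ, α < γ ∧ ∃ G : ℝ, 0 < G ∧
    ∀ (d : ℕ) (x F : ℕ → EuclideanSpace ℝ (Fin d)) (a : ℝ), 0 ≤ a →
      (∀ n : ℕ, 1 ≤ n → ∑ j ∈ Finset.range (n + 1), w n (n - j) • x j = H • F n) →
      (∀ n : ℕ, 1 ≤ n → inner ℝ (F n) (x n) ≤ a - b * ‖x n‖ ^ 2) →
      ∀ n : ℕ, 1 ≤ n → ‖x n‖ ^ 2 ≤ c * (a / b) + G * (‖x 0‖ ^ 2 + a / b) * (n : ℝ) ^ (-γ)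

/-- The weights `w n j` coincide with `ω j` except at the two initial points, where the deviation
is of order `n ^ (-α)`; the first step is a multiple of `x₁ - x₀`. -/
structure IsAsymptoticKernel (w : ℕ → ℕ → ℝ) (ω : ℕ → ℝ) (α K : ℝ) : Prop where
  pos : 0 < w 1 0
  first : w 1 1 = -w 1 0
  regular : ∀ n j : ℕ, j + 2 ≤ n → w n j = ω j
  second_last : ∀ n : ℕ, 2 ≤ n → |w n (n - 1) - ω (n - 1)| ≤ K * (n : ℝ) ^ (-α)
  last : ∀ n : ℕ, 2 ≤ n → |w n n| ≤ K * (n : ℝ) ^ (-α)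

lemma IsAsymptoticKernel.first_step_le {w : ℕ → ℕ → ℝ} {ω : ℕ → ℝ} {α K H a b : ℝ}
    (hw : IsAsymptoticKernel w ω α K) (hH : 0 < H) (hb : 0 < b) {d : ℕ}
    {x₀ x₁ F : EuclideanSpace ℝ (Fin d)}
    (hx : w 1 1 • x₀ + w 1 0 • x₁ = H • F) (hF : inner ℝ F x₁ ≤ a - b * ‖x₁‖ ^ 2)
    (ha : 0 ≤ a) : ‖x₁‖ ^ 2 ≤ ‖x₀‖ ^ 2 + a / b := by
  have h := congrArg (fun v => 2 * inner ℝ v x₁) hx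
  simp only [inner_add_left, real_inner_smul_left, hw.first, real_inner_self_eq_norm_sq] at h
  have h1 := (abs_le.mp (abs_two_mul_inner_le x₀ x₁ one_pos)).2
  have h2 := mul_le_mul_of_nonneg_left h1 hw.pos.le
  have h3 := mul_le_mul_of_nonneg_left hF hH.le
  by_contra! hc
  have hab : b * (a / b) = a := by field_simp
  have hab0 : 0 ≤ a / b := by positivity
  have h4 : 0 < w 1 0 * (‖x₁‖ ^ 2 - ‖x₀‖ ^ 2) := mul_pos hw.pos (by linarith)
  have h5 : 0 ≤ H * (b * ‖x₁‖ ^ 2 - a) := by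
    refine mul_nonneg hH.le ?_
    nlinarith [sq_nonneg ‖x₀‖]
  simp only [div_one, one_mul] at h2
  nlinarith

lemma IsAsymptoticKernel.two_mul_conv_inner_le {w : ℕ → ℕ → ℝ} {ω : ℕ → ℝ} {α K H a b : ℝ}
    (hw : IsAsymptoticKernel w ω α K) (hH : 0 < H) (hb : 0 < b) {d : ℕ}
    {x X F : ℕ → EuclideanSpace ℝ (Fin d)} (hX0 : X 0 = 0) (hX : ∀ n, 1 ≤ n → X n = x n)
    {n : ℕ} (hn : 2 ≤ n)
    (hx : ∑ j ∈ Finset.range (n + 1), w n (n - j) • x j = H • F n)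
    (hF : inner ℝ (F n) (x n) ≤ a - b * ‖x n‖ ^ 2) :
    7 / 4 * (H * b) * ‖X n‖ ^ 2 +
        2 * ∑ j ∈ Finset.range (n + 1), ω j * inner ℝ (X n) (X (n - j)) ≤
      2 * H * a + 8 * K ^ 2 / (H * b) * (‖x 0‖ ^ 2 + ‖x 1‖ ^ 2) * (n : ℝ) ^ (-(2 * α)) := by
  obtain ⟨m, rfl⟩ : ∃ m, n = m + 2 := ⟨n - 2, by omega⟩
  have hHb : 0 < H * b := by positivity
  set c₁ : ℝ := w (m + 2) (m + 1) - ω (m + 1) with hc₁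
  set c₀ : ℝ := w (m + 2) (m + 2) with hc₀
  set R : EuclideanSpace ℝ (Fin d) := c₁ • x 1 + c₀ • x 0 with hR
  have hconv : ∑ j ∈ Finset.range (m + 2 + 1), ω j • X (m + 2 - j) = H • F (m + 2) - R := by
    have hflip := Finset.sum_flip (n := m + 2) fun j => ω (m + 2 - j) • X j
    have he : ∑ j ∈ Finset.range (m + 2 + 1), ω j • X (m + 2 - j) =
        ∑ j ∈ Finset.range (m + 2 + 1), ω (m + 2 - j) • X j := by
      rw [← hflip]
      refine Finset.sum_congr rfl fun j hj => ?_
      have : j ≤ m + 2 := Nat.lt_succ_iff.mp (Finset.mem_range.mp hj)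
      rw [Nat.sub_sub_self this]
    rw [he, ← hx, hR, Finset.sum_range_succ', Finset.sum_range_succ', Finset.sum_range_succ' _ (m + 2),
      Finset.sum_range_succ' _ (m + 1)]
    have hrest : ∑ k ∈ Finset.range (m + 1), ω (m + 2 - (k + 1 + 1)) • X (k + 1 + 1) =
        ∑ k ∈ Finset.range (m + 1), w (m + 2) (m + 2 - (k + 1 + 1)) • x (k + 1 + 1) := by
      refine Finset.sum_congr rfl fun k hk => ?_
      have hk' : k < m + 1 := Finset.mem_range.mp hk
      rw [hX _ (by omega), hw.regular (m + 2) _ (by omega)]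
    rw [hrest]
    simp only [zero_add, Nat.sub_zero, show m + 2 - 1 = m + 1 by omega, hX0, hX 1 le_rfl, smul_zero]
    rw [hc₁, hc₀, sub_smul]
    abel
  have hinner : ∑ j ∈ Finset.range (m + 2 + 1), ω j * inner ℝ (X (m + 2)) (X (m + 2 - j)) =
      H * inner ℝ (F (m + 2)) (x (m + 2)) - inner ℝ (x (m + 2)) R := by
    have := congrArg (fun v => inner ℝ (X (m + 2)) v) hconv
    simp only [inner_sum, inner_sub_right, real_inner_smul_right] at this
    rw [this, hX (m + 2) (by omega), real_inner_comm (x (m + 2)) (F (m + 2))]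
  have hyoung := (abs_le.mp (abs_two_mul_inner_le (x (m + 2)) R
    (by positivity : 0 < 4 / (H * b)))).1
  have hb1 : ‖x (m + 2)‖ ^ 2 / (4 / (H * b)) = H * b / 4 * ‖x (m + 2)‖ ^ 2 := by field_simp
  have hp : ((m + 2 : ℕ) : ℝ) ^ (-(2 * α)) = (((m + 2 : ℕ) : ℝ) ^ (-α)) ^ 2 := by
    rw [← Real.rpow_natCast, ← Real.rpow_mul (Nat.cast_nonneg _)]
    congr 1; push_cast; ring
  set t : ℝ := ((m + 2 : ℕ) : ℝ) ^ (-α) with ht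
  have ht0 : 0 ≤ t := by positivity
  have hRn : ‖R‖ ^ 2 ≤ 2 * K ^ 2 * t ^ 2 * (‖x 0‖ ^ 2 + ‖x 1‖ ^ 2) := by
    have h1 : |c₁| ≤ K * t := hw.second_last (m + 2) (by omega)
    have h0 : |c₀| ≤ K * t := hw.last (m + 2) (by omega)
    have hn1 : ‖R‖ ≤ K * t * (‖x 1‖ + ‖x 0‖) := by
      calc ‖R‖ ≤ ‖c₁ • x 1‖ + ‖c₀ • x 0‖ := norm_add_le _ _
        _ = |c₁| * ‖x 1‖ + |c₀| * ‖x 0‖ := by rw [norm_smul, norm_smul]; rfl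
        _ ≤ K * t * ‖x 1‖ + K * t * ‖x 0‖ := by gcongr
        _ = _ := by ring
    calc ‖R‖ ^ 2 ≤ (K * t * (‖x 1‖ + ‖x 0‖)) ^ 2 := pow_le_pow_left₀ (norm_nonneg _) hn1 2
      _ = K ^ 2 * t ^ 2 * (‖x 1‖ + ‖x 0‖) ^ 2 := by ring
      _ ≤ K ^ 2 * t ^ 2 * (2 * (‖x 0‖ ^ 2 + ‖x 1‖ ^ 2)) := by
          refine mul_le_mul_of_nonneg_left ?_ (by positivity)
          nlinarith [sq_nonneg (‖x 1‖ - ‖x 0‖)]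
      _ = _ := by ring
  have hRn' := mul_le_mul_of_nonneg_left hRn (by positivity : 0 ≤ 4 / (H * b))
  have he2 : 4 / (H * b) * (2 * K ^ 2 * t ^ 2 * (‖x 0‖ ^ 2 + ‖x 1‖ ^ 2)) =
      8 * K ^ 2 / (H * b) * (‖x 0‖ ^ 2 + ‖x 1‖ ^ 2) * t ^ 2 := by ring
  have hF' := mul_le_mul_of_nonneg_left hF hH.le
  rw [hinner, hp, hX (m + 2) (by omega)]
  rw [hb1] at hyoung
  linarith

theorem forcedDecay_of_kernel {w : ℕ → ℕ → ℝ} {ω η ν : ℕ → ℝ} {α K K' H b k₀ k₁ r κ : ℝ}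
    (hα0 : 0 < α) (hα1 : α < 1) (hH : 0 < H) (hb : 0 < b)
    (hw : IsAsymptoticKernel w ω α K) (hQ : QuadraticLowerBound ω η k₀ k₁)
    (hr1 : r ≤ 1 / 10) (hκ : 0 ≤ κ)
    (hν0 : ν 0 = η 0 + 7 / 4 * (H * b)) (hνs : ∀ j, ν (j + 1) = η (j + 1) + r * ν j)
    (hν : ∀ j, 1 ≤ j → ν j ≤ 0) (hk₀ : κ * ν 0 ≤ k₀) (hk₁ : k₁ ≤ -(κ * ν 1))
    (hsum : ∀ n : ℕ, H * b / 2 ≤ ∑ j ∈ Finset.range (n + 1), ν j)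
    (hK : ∀ j : ℕ, |ν j| ≤ K' * ((j : ℝ) + 1) ^ (-(1 + α))) :
    ForcedDecay w α 5 H b := by
  set γ : ℝ := min (2 * α) ((1 + α) / 2) with hγ
  have hαγ : α < γ := lt_min (by linarith) (by linarith)
  have hγ0 : 0 < γ := hα0.trans hαγ
  have hγ1 : γ < 1 := (min_le_right _ _).trans_lt (by linarith)
  have hHb : 0 < H * b := by positivity
  obtain ⟨G, hG, hcmp⟩ := exists_comparison_const hα0 hγ0 hγ1 (half_pos hHb) hν hsum hK
  set M₀ : ℝ := 8 * K ^ 2 / (H * b) + (1 + κ) with hM₀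
  have hM₀pos : 0 < M₀ := by positivity
  refine ⟨γ, hαγ, 4 * G * M₀, by positivity, ?_⟩
  intro d x F a ha hx hF
  have hab : 0 ≤ a / b := by positivity
  have hx1 : ‖x 1‖ ^ 2 ≤ ‖x 0‖ ^ 2 + a / b := by
    refine hw.first_step_le hH hb (F := F 1) ?_ (hF 1 le_rfl) ha
    have := hx 1 le_rfl
    simpa [Finset.sum_range_succ] using this
  set X : ℕ → EuclideanSpace ℝ (Fin d) := fun n => if n = 0 then 0 else x n with hXdef
  have hX0 : X 0 = 0 := by simp [hXdef]
  have hX : ∀ n, 1 ≤ n → X n = x n := fun n hn => by simp [hXdef, show n ≠ 0 by omega]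
  set M : ℝ := M₀ * (‖x 0‖ ^ 2 + ‖x 1‖ ^ 2) with hM
  have hMpos : 0 ≤ M := by positivity
  have hE := hcmp (schemeEnergy r κ X) (2 * H * a) M (by positivity) hMpos
    (by simp [schemeEnergy]) (by
      have h1 : schemeEnergy r κ X 1 = (1 + κ) * ‖x 1‖ ^ 2 := by
        simp [schemeEnergy, hX0, hX 1 le_rfl]; ring
      have h2 : 0 ≤ 2 * H * a / (H * b / 2) := by positivity
      have h3 : 0 ≤ 8 * K ^ 2 / (H * b) * (‖x 0‖ ^ 2 + ‖x 1‖ ^ 2) + (1 + κ) * ‖x 0‖ ^ 2 := by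
        positivity
      rw [h1, hM, hM₀]
      linarith)
    (fun n hn => by
      refine (conv_schemeEnergy_le hQ hκ hν0 hνs hν hk₀ hk₁ X hX0 n hn).trans ?_
      refine (hw.two_mul_conv_inner_le hH hb hX0 hX hn (hx n (by omega))
        (hF n (by omega))).trans ?_
      have h1 : (n : ℝ) ^ (-(2 * α)) ≤ (n : ℝ) ^ (-γ) :=
        Real.rpow_le_rpow_of_exponent_le (by exact_mod_cast (by omega : 1 ≤ n))
          (by linarith [min_le_left (2 * α) ((1 + α) / 2)])
      have h2 : 8 * K ^ 2 / (H * b) * (‖x 0‖ ^ 2 + ‖x 1‖ ^ 2) ≤ M := by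
        have : 0 ≤ (1 + κ) * (‖x 0‖ ^ 2 + ‖x 1‖ ^ 2) := by positivity
        rw [hM, hM₀]; linarith
      have h3 : 8 * K ^ 2 / (H * b) * (‖x 0‖ ^ 2 + ‖x 1‖ ^ 2) * (n : ℝ) ^ (-(2 * α)) ≤
          M * (n : ℝ) ^ (-γ) := mul_le_mul h2 h1 (by positivity) hMpos
      linarith)
  have hA : 2 * H * a / (H * b / 2) = 4 * (a / b) := by field_simp; ring
  rw [hA] at hE
  have hstep : ∀ n, 1 ≤ n → ‖X n‖ ^ 2 ≤ 5 * (a / b) + 2 * G * M * (n : ℝ) ^ (-γ) := by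
    intro n hn
    induction n, hn using Nat.le_induction with
    | base =>
      have h := hE 1 le_rfl
      have h1 : ‖X 1‖ ^ 2 ≤ schemeEnergy r κ X 1 := by
        simp [schemeEnergy, hX0]; positivity
      have h2 : 0 ≤ G * M := by positivity
      rw [Nat.cast_one, Real.one_rpow] at h ⊢
      linarith
    | succ n hn ih =>
      have h := hE (n + 1) (by omega)
      have h1 : ‖X (n + 1)‖ ^ 2 - r * ‖X n‖ ^ 2 ≤ schemeEnergy r κ X (n + 1) := by
        simp [schemeEnergy]; positivity
      have hnR : (1 : ℝ) ≤ n := by exact_mod_cast hn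
      have h2 : (n : ℝ) ^ (-γ) ≤ 2 * ((n + 1 : ℕ) : ℝ) ^ (-γ) := by
        calc (n : ℝ) ^ (-γ) ≤ (((n + 1 : ℕ) : ℝ) / 2) ^ (-γ) :=
              Real.rpow_le_rpow_of_nonpos (by positivity) (by push_cast; linarith) (by linarith)
          _ = 2 ^ γ * ((n + 1 : ℕ) : ℝ) ^ (-γ) := by
              rw [Real.div_rpow (by positivity) (by norm_num),
                Real.rpow_neg (by norm_num : (0 : ℝ) ≤ 2), div_inv_eq_mul, mul_comm]
          _ ≤ 2 * ((n + 1 : ℕ) : ℝ) ^ (-γ) := by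
              refine mul_le_mul_of_nonneg_right ?_ (by positivity)
              simpa using Real.rpow_le_rpow_of_exponent_le (one_le_two : (1 : ℝ) ≤ 2) hγ1.le
      set s : ℝ := ((n + 1 : ℕ) : ℝ) ^ (-γ) with hs
      have hs0 : 0 ≤ s := by positivity
      have h3 : ‖X n‖ ^ 2 ≤ 5 * (a / b) + 4 * (G * M * s) := by
        have := mul_le_mul_of_nonneg_left h2 (by positivity : 0 ≤ 2 * G * M)
        linarith
      have h4 : r * ‖X n‖ ^ 2 ≤ 1 / 10 * (5 * (a / b) + 4 * (G * M * s)) :=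
        mul_le_mul hr1 h3 (sq_nonneg _) (by norm_num)
      have h5 : 0 ≤ G * M * s := by positivity
      linarith
  intro n hn
  have h := hstep n hn
  rw [hX n hn] at h
  refine h.trans ?_
  have hM2 : M ≤ M₀ * (2 * (‖x 0‖ ^ 2 + a / b)) :=
    mul_le_mul_of_nonneg_left (by linarith) hM₀pos.le
  have h6 := mul_le_mul_of_nonneg_left hM2 (by positivity : 0 ≤ 2 * G * (n : ℝ) ^ (-γ))
  linarith

lemma exists_forall_abs_le_of_tail {f : ℕ → ℝ} {p K : ℝ} {J : ℕ}
    (h : ∀ j, J ≤ j → |f j| ≤ K * ((j : ℝ) + 1) ^ (-p)) :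
    ∃ K' : ℝ, ∀ j : ℕ, |f j| ≤ K' * ((j : ℝ) + 1) ^ (-p) := by
  have hpos : ∀ j : ℕ, (0 : ℝ) < ((j : ℝ) + 1) ^ (-p) := fun j => by positivity
  have hO : f =O[Filter.atTop] fun j : ℕ => ((j : ℝ) + 1) ^ (-p) := by
    refine Asymptotics.IsBigO.of_bound K (Filter.eventually_atTop.mpr ⟨J, fun j hj => ?_⟩)
    rw [Real.norm_eq_abs, Real.norm_of_nonneg (hpos j).le]
    exact h j hj
  obtain ⟨C, -, hC⟩ := Asymptotics.bound_of_isBigO_nat_atTop hO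
  refine ⟨C, fun j => ?_⟩
  have := hC (x := j) (hpos j).ne'
  rwa [Real.norm_eq_abs, Real.norm_of_nonneg (hpos j).le] at this

/-- Coefficients of `(∑ ω_j ξ^j + B) / (1 - r ξ)`. -/
def geometricKernel (ω : ℕ → ℝ) (r B : ℝ) : ℕ → ℝ
  | 0 => ω 0 + B
  | j + 1 => ω (j + 1) + r * geometricKernel ω r B j

theorem forcedDecay_of_geometricKernel {w : ℕ → ℕ → ℝ} {ω : ℕ → ℝ} {α K K' H b r κ : ℝ}
    (hα0 : 0 < α) (hα1 : α < 1) (hH : 0 < H) (hb : 0 < b) (hw : IsAsymptoticKernel w ω α K)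
    (hr0 : 0 ≤ r) (hr1 : r ≤ 1 / 10) (hκ : 0 ≤ κ)
    (h1 : ω 1 + r * (ω 0 + 7 / 4 * (H * b)) ≤ 0)
    (h2 : ω 2 + r * (ω 1 + r * (ω 0 + 7 / 4 * (H * b))) ≤ 0)
    (h3 : ∀ j, 3 ≤ j → ω j ≤ 0)
    (hsum : ∀ n, 0 ≤ ∑ j ∈ Finset.range (n + 1), ω j)
    (hk₀ : κ * (ω 0 + 7 / 4 * (H * b)) ≤ -ω 1 - 2 * max (ω 2) 0)
    (hk₁ : 2 * max (ω 2) 0 ≤ -(κ * (ω 1 + r * (ω 0 + 7 / 4 * (H * b)))))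
    (hK : ∀ j : ℕ, |ω j| ≤ K' * ((j : ℝ) + 1) ^ (-(1 + α))) :
    ForcedDecay w α 5 H b := by
  have hHb : 0 < H * b := by positivity
  set B : ℝ := 7 / 4 * (H * b) with hB
  have hB0 : 0 < B := by positivity
  obtain ⟨S, hS, hgeo⟩ := exists_geometric_conv_rpow_le hr0 (by linarith : r < 1)
    (by linarith : 0 ≤ 1 + α) (by linarith)
  have hK'0 : 0 ≤ K' := by simpa using (abs_nonneg _).trans (hK 0)
  have hneg : ∀ j, 1 ≤ j → geometricKernel ω r B j ≤ 0 := by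
    intro j hj
    induction j, hj using Nat.le_induction with
    | base => simpa [geometricKernel] using h1
    | succ j hj ih =>
      rcases Nat.eq_or_lt_of_le hj with h | h
      · subst h
        simpa [geometricKernel] using h2
      · have := h3 (j + 1) (by omega)
        have := mul_nonpos_of_nonneg_of_nonpos hr0 ih
        simp only [geometricKernel]
        linarith
  refine forcedDecay_of_kernel (η := ω) (ν := geometricKernel ω r B) (r := r) (κ := κ)
    (K' := (K' + B) * S) hα0 hα1 hH hb hw
    (quadraticLowerBound_self h3 fun n _ => hsum n) hr1 hκ rfl (fun _ => rfl) hneg hk₀ hk₁ ?_ ?_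
  · have hS : ∀ n : ℕ, ∑ j ∈ Finset.range (n + 1), geometricKernel ω r B j =
        ∑ j ∈ Finset.range (n + 1), ω j + B +
          r * ∑ j ∈ Finset.range n, geometricKernel ω r B j := by
      intro n
      rw [Finset.sum_range_succ', Finset.sum_range_succ', Finset.mul_sum]
      simp only [geometricKernel, Finset.sum_add_distrib]
      ring
    have hSB : ∀ n : ℕ, B ≤ ∑ j ∈ Finset.range (n + 1), geometricKernel ω r B j := by
      intro n
      induction n with
      | zero =>
        have := hsum 0
        simp only [zero_add, Finset.sum_range_one, geometricKernel] at this ⊢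
        linarith
      | succ n ih =>
        rw [hS]
        have := hsum (n + 1)
        have := mul_nonneg hr0 (hB0.le.trans ih)
        linarith
    intro n
    have := hSB n
    linarith
  · have hbd : ∀ n : ℕ, |geometricKernel ω r B n| ≤ (K' + B) *
        ∑ l ∈ Finset.range (n + 1), r ^ l * (((n - l : ℕ) : ℝ) + 1) ^ (-(1 + α)) := by
      intro n
      induction n with
      | zero =>
        have := hK 0
        simp [geometricKernel] at this ⊢
        calc |ω 0 + B| ≤ |ω 0| + |B| := abs_add_le _ _
          _ ≤ K' + B := by rw [abs_of_pos hB0]; linarith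
      | succ n ih =>
        rw [Finset.sum_range_succ']
        have he : ∑ l ∈ Finset.range (n + 1),
            r ^ (l + 1) * (((n + 1 - (l + 1) : ℕ) : ℝ) + 1) ^ (-(1 + α)) =
            r * ∑ l ∈ Finset.range (n + 1), r ^ l * (((n - l : ℕ) : ℝ) + 1) ^ (-(1 + α)) := by
          rw [Finset.mul_sum]
          refine Finset.sum_congr rfl fun l _ => ?_
          rw [Nat.add_sub_add_right]; ring
        rw [he]
        have h4 := hK (n + 1)
        have h5 := mul_le_mul_of_nonneg_left ih hr0
        have h6 : 0 ≤ B * (((n + 1 : ℕ) : ℝ) + 1) ^ (-(1 + α)) := by positivity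
        simp only [geometricKernel, pow_zero, one_mul, Nat.sub_zero]
        calc |ω (n + 1) + r * geometricKernel ω r B n|
            ≤ |ω (n + 1)| + |r * geometricKernel ω r B n| := abs_add_le _ _
          _ = |ω (n + 1)| + r * |geometricKernel ω r B n| := by rw [abs_mul, abs_of_nonneg hr0]
          _ ≤ _ := by linarith
    intro n
    refine (hbd n).trans ?_
    rw [mul_assoc]
    exact mul_le_mul_of_nonneg_left (hgeo n) (by positivity)

theorem forcedDecay_of_nonpos {w : ℕ → ℕ → ℝ} {ω : ℕ → ℝ} {α K K' H b : ℝ}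
    (hα0 : 0 < α) (hα1 : α < 1) (hH : 0 < H) (hb : 0 < b) (hw : IsAsymptoticKernel w ω α K)
    (h : ∀ j, 1 ≤ j → ω j ≤ 0) (hsum : ∀ n, 0 ≤ ∑ j ∈ Finset.range (n + 1), ω j)
    (hK : ∀ j : ℕ, |ω j| ≤ K' * ((j : ℝ) + 1) ^ (-(1 + α))) :
    ForcedDecay w α 5 H b := by
  have h1 := h 1 le_rfl
  have h2 := h 2 (by norm_num)
  refine forcedDecay_of_geometricKernel (r := 0) (κ := 0) hα0 hα1 hH hb hw le_rfl (by norm_num)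
    le_rfl (by linarith) (by linarith) (fun j hj => h j (by omega)) hsum ?_ ?_ hK
  · rw [max_eq_right h2]; linarith
  · rw [max_eq_right h2]; linarith

theorem forcedDecay_of_shiftedKernel {w : ℕ → ℕ → ℝ} {ω : ℕ → ℝ} {α K K' H b : ℝ}
    (hα0 : 0 < α) (hα1 : α < 1) (hH : 0 < H) (hb : 0 < b) (hw : IsAsymptoticKernel w ω α K)
    (h12 : ω 1 + ω 2 < 0) (h2 : 0 < ω 2) (h3 : 16 * max (ω 3) 0 ≤ H * b)
    (h4 : ∀ j, 4 ≤ j → ω j ≤ 0)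
    (hsum : ∀ n, 2 ≤ n → 0 ≤ ∑ j ∈ Finset.range (n + 1), ω j)
    (hcond : ω 2 ^ 2 * (ω 0 + H * b) ≤ H * b * (ω 1 + ω 2) ^ 2)
    (hK : ∀ j : ℕ, |ω j| ≤ K' * ((j : ℝ) + 1) ^ (-(1 + α))) :
    ForcedDecay w α 5 H b := by
  have hHb : 0 < H * b := by positivity
  set B : ℝ := H * b with hB
  set T : ℝ := -ω 1 - ω 2 with hT
  have hT0 : 0 < T := by linarith
  have hτ : 0 < ω 2 / B := by positivity
  set η := shiftedKernel ω (ω 2 / B) with hη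
  set ν := geometricKernel η 0 (7 / 4 * B) with hνdef
  have hνs : ∀ j, ν (j + 1) = η (j + 1) := fun j => by simp [hνdef, geometricKernel]
  have hν0 : ν 0 = ω 0 + 3 / 4 * B - 2 * max (ω 3) 0 := by
    have : ω 2 / (ω 2 / B) = B := by field_simp
    simp only [hνdef, geometricKernel, hη, shiftedKernel, this]
    simp only [if_true]; ring
  have hν1 : ν 1 = ω 1 + ω 2 := by rw [hνs]; simp [hη, shiftedKernel]
  have hν2 : ν 2 = 0 := by rw [hνs]; simp [hη, shiftedKernel]
  have hν3 : ∀ j, ν (j + 3) = -|ω (j + 3)| := fun j => by rw [hνs]; simp [hη, shiftedKernel]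
  have hneg : ∀ j, 1 ≤ j → ν j ≤ 0 := by
    intro j hj
    obtain rfl | rfl | ⟨i, rfl⟩ : j = 1 ∨ j = 2 ∨ ∃ i, j = i + 3 := by
      rcases Nat.lt_or_ge j 3 with h | h
      · omega
      · exact Or.inr (Or.inr ⟨j - 3, by omega⟩)
    · rw [hν1]; exact h12.le
    · rw [hν2]
    · rw [hν3]; exact neg_nonpos.mpr (abs_nonneg _)
  obtain ⟨K'', hK''⟩ : ∃ K'' : ℝ, ∀ j : ℕ, |ν j| ≤ K'' * ((j : ℝ) + 1) ^ (-(1 + α)) := by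
    refine exists_forall_abs_le_of_tail (J := 3) (K := K') fun j hj => ?_
    obtain ⟨i, rfl⟩ : ∃ i, j = i + 3 := ⟨j - 3, by omega⟩
    rw [hν3, abs_neg, abs_abs]
    exact hK _
  have hm0 : 0 ≤ max (ω 3) 0 := le_max_right _ _
  refine forcedDecay_of_kernel (η := η) (ν := ν) (r := 0) (κ := ω 2 ^ 2 / (B * T))
    (K' := K'') hα0 hα1 hH hb hw (quadraticLowerBound_shifted hτ h2.le h4 hsum) (by norm_num)
    (by positivity) rfl (fun _ => rfl) hneg ?_ ?_ ?_ hK''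
  · rw [hν0, div_mul_eq_mul_div, div_le_iff₀ (by positivity)]
    have h5 : ω 2 ^ 2 * (ω 0 + 3 / 4 * B - 2 * max (ω 3) 0) ≤ ω 2 ^ 2 * (ω 0 + B) :=
      mul_le_mul_of_nonneg_left (by linarith) (sq_nonneg _)
    have h6 : (-ω 1 - ω 2) * (B * T) = B * (ω 1 + ω 2) ^ 2 := by rw [hT]; ring
    linarith
  · rw [hν1]
    have : ω 2 ^ 2 / (B * T) * (ω 1 + ω 2) = -(ω 2 * (ω 2 / B)) := by
      have h7 : ω 1 + ω 2 = -T := by rw [hT]; ring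
      rw [h7]
      field_simp
    linarith
  · have hlarge : ∀ m : ℕ, B / 2 ≤ ∑ j ∈ Finset.range (m + 4), ν j := by
      intro m
      have h5 := hsum (m + 3) (by omega)
      rw [Finset.sum_range_succ', Finset.sum_range_succ', Finset.sum_range_succ',
        Finset.sum_range_succ'] at h5 ⊢
      have h6 : ∑ k ∈ Finset.range m, ν (k + 1 + 1 + 1 + 1) =
          ∑ k ∈ Finset.range m, ω (k + 1 + 1 + 1 + 1) := by
        refine Finset.sum_congr rfl fun k _ => ?_
        rw [hν3 (k + 1), abs_of_nonpos (h4 _ (by omega)), neg_neg]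
      have h7 : ν (0 + 1 + 1 + 1) = ω 3 - 2 * max (ω 3) 0 := by
        rw [show 0 + 1 + 1 + 1 = 0 + 3 from rfl, hν3]
        rcases le_total (ω 3) 0 with h | h
        · simp [h, abs_of_nonpos h]
        · simp only [zero_add, max_eq_left h, abs_of_nonneg h]
          ring
      have h8 : ν (0 + 1 + 1) = 0 := hν2
      have h9 : ν (0 + 1) = ω 1 + ω 2 := hν1
      rw [h6, h7, h8, h9, hν0]
      simp only [zero_add, show 1 + 1 = 2 from rfl, show 2 + 1 = 3 from rfl] at h5
      linarith
    intro n
    refine (hlarge n).trans ?_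
    rw [show n + 4 = (n + 1) + 3 from rfl, Finset.sum_range_add]
    have : ∑ x ∈ Finset.range 3, ν (n + 1 + x) ≤ 0 :=
      Finset.sum_nonpos fun k _ => hneg _ (by omega)
    linarith

/-! ## Consequences of forced decay -/

lemma ForcedDecay.of_scaled {w : ℕ → ℕ → ℝ} {α c H b : ℝ} (m : ℝ)
    (h : ForcedDecay (fun n j => m⁻¹ * w n j) α c (m⁻¹ * H) b) : ForcedDecay w α c H b := by
  obtain ⟨γ, hγ, G, hG, hmain⟩ := h
  refine ⟨γ, hγ, G, hG, fun d x F a ha hx hF => hmain d x F a ha (fun n hn => ?_) hF⟩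
  simp only [mul_smul, ← Finset.smul_sum, hx n hn]

lemma exists_mul_rpow_neg_le {α γ G c : ℝ} (hαγ : α < γ) (hc : 0 < c) :
    ∃ N : ℕ, 1 ≤ N ∧ ∀ n : ℕ, N ≤ n → G * (n : ℝ) ^ (-γ) ≤ c * (n : ℝ) ^ (-α) := by
  have hlim : Filter.Tendsto (fun n : ℕ => G * (n : ℝ) ^ (-(γ - α))) Filter.atTop (nhds 0) := by
    simpa using ((tendsto_rpow_neg_atTop (sub_pos.mpr hαγ)).comp
      tendsto_natCast_atTop_atTop).const_mul G
  obtain ⟨N, hN⟩ := Filter.eventually_atTop.mp (hlim.eventually (gt_mem_nhds hc))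
  refine ⟨max N 1, le_max_right _ _, fun n hn => ?_⟩
  have hn0 : (0 : ℝ) < n := by exact_mod_cast (le_max_right N 1).trans hn
  have h := hN n ((le_max_left _ _).trans hn)
  have he : (n : ℝ) ^ (-γ) = (n : ℝ) ^ (-(γ - α)) * (n : ℝ) ^ (-α) := by
    rw [← Real.rpow_add hn0]; congr 1; ring
  rw [he, ← mul_assoc]
  exact mul_le_mul_of_nonneg_right h.le (by positivity)

lemma rpow_neg_le_rpow_neg_of_lt {α γ : ℝ} (hαγ : α < γ) {n : ℕ} (hn : 1 ≤ n) :
    (n : ℝ) ^ (-γ) ≤ (n : ℝ) ^ (-α) :=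
  Real.rpow_le_rpow_of_exponent_le (by exact_mod_cast hn) (by linarith)

theorem ForcedDecay.schemeContractive {w : ℕ → ℕ → ℝ} {α c c' h lam : ℝ} (hc' : 0 < c')
    (hd : ForcedDecay w α c (h ^ α) (-lam)) (hh : 0 < h) :
    SchemeContractive w α c' h lam := by
  obtain ⟨γ, hγ, G, hG, hmain⟩ := hd
  obtain ⟨N, hN1, hN⟩ := exists_mul_rpow_neg_le (G := G) hγ hc'
  refine ⟨G, hG, N, hN1, fun d f hf x y hx hy => ?_⟩
  have hb : ∀ n : ℕ, 1 ≤ n → ‖x n - y n‖ ^ 2 ≤ ‖x 0 - y 0‖ ^ 2 * (G * (n : ℝ) ^ (-γ)) := by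
    intro n hn
    have := hmain d (fun n => x n - y n)
      (fun n => f ((n : ℝ) * h) (x n) - f ((n : ℝ) * h) (y n)) 0 le_rfl
      (fun n hn => by
        simp only [smul_sub, Finset.sum_sub_distrib]
        rw [hx n hn, hy n hn])
      (fun n hn => by
        have hn0 : (0 : ℝ) < n := by exact_mod_cast hn
        have := hf ((n : ℝ) * h) (by positivity) (x n) (y n)
        linarith) n hn
    simp only [zero_div, mul_zero, zero_add, add_zero] at this
    linarith
  have hdiv : ∀ (C : ℝ) (n : ℕ), C / (n : ℝ) ^ α = C * (n : ℝ) ^ (-α) := fun C n => by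
    rw [Real.rpow_neg (Nat.cast_nonneg n), div_eq_mul_inv]
  refine ⟨fun n hn => (hb n hn).trans (mul_le_mul_of_nonneg_left ?_ (sq_nonneg _)),
    fun n hn => (hb n (hN1.trans hn)).trans (mul_le_mul_of_nonneg_left ?_ (sq_nonneg _))⟩
  · rw [hdiv]
    exact mul_le_mul_of_nonneg_left (rpow_neg_le_rpow_neg_of_lt hγ hn) hG.le
  · rw [hdiv]
    exact hN n hn

theorem ForcedDecay.schemeDecay {w : ℕ → ℕ → ℝ} {α c c' h b : ℝ} (hc' : 0 < c')
    (hd : ForcedDecay w α c (h ^ α) b) (hh : 0 < h) : SchemeDecay w α c' h b := by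
  obtain ⟨γ, hγ, G, hG, hmain⟩ := hd
  obtain ⟨N, hN1, hN⟩ := exists_mul_rpow_neg_le (G := G) hγ hc'
  refine ⟨G, hG, N, hN1, fun d f hf x hx => ?_⟩
  have hb : ∀ n : ℕ, 1 ≤ n → ‖x n‖ ^ 2 ≤ ‖x 0‖ ^ 2 * (G * (n : ℝ) ^ (-γ)) := by
    intro n hn
    have := hmain d x (fun n => f ((n : ℝ) * h) (x n)) 0 le_rfl hx
      (fun n hn => by
        have hn0 : (0 : ℝ) < n := by exact_mod_cast hn
        exact hf ((n : ℝ) * h) (by positivity) (x n)) n hn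
    simp only [zero_div, mul_zero, zero_add, add_zero] at this
    linarith
  refine ⟨fun n hn => (hb n hn).trans ?_, fun n hn => (hb n (hN1.trans hn)).trans ?_⟩
  · have := mul_le_mul_of_nonneg_left (rpow_neg_le_rpow_neg_of_lt hγ hn)
      (by positivity : 0 ≤ G * ‖x 0‖ ^ 2)
    linarith
  · have := mul_le_mul_of_nonneg_left (hN n hn) (sq_nonneg ‖x 0‖)
    linarith

theorem ForcedDecay.schemeDissipative {w : ℕ → ℕ → ℝ} {α c h a b : ℝ} (hα : 0 < α) (hc : 0 ≤ c)
    (hd : ForcedDecay w α c (h ^ α) b) (hh : 0 < h) (ha : 0 ≤ a) (hb : 0 < b) :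
    SchemeDissipative w α c h a b := by
  obtain ⟨γ, hγ, G, hG, hmain⟩ := hd
  intro d f hf x₀ ε hε
  have hγ0 : (0 : ℝ) < γ := hα.trans hγ
  obtain ⟨N, hN1, hN⟩ := exists_mul_rpow_neg_le (α := 0) (G := G * (‖x₀‖ ^ 2 + a / b)) hγ0
    (by positivity : 0 < ε ^ 2 / 2)
  refine ⟨N, hN1, fun x hx hx0 n hn => ?_⟩
  have h1 := hmain d x (fun n => f ((n : ℝ) * h) (x n)) a ha hx
    (fun n hn => by
      have hn0 : (0 : ℝ) < n := by exact_mod_cast hn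
      exact hf ((n : ℝ) * h) (by positivity) (x n)) n (hN1.trans hn)
  have h2 := hN n hn
  rw [neg_zero, Real.rpow_zero, mul_one] at h2
  rw [hx0] at h1
  rw [mem_ball_zero_iff]
  have hca : 0 ≤ c * a / b := by positivity
  have hs := Real.sqrt_nonneg (c * a / b)
  refine lt_of_pow_lt_pow_left₀ 2 (by positivity) ?_
  have h3 := Real.sq_sqrt hca
  have h4 : c * (a / b) = c * a / b := by ring
  nlinarith [mul_nonneg hs hε.le, sq_pos_of_pos hε]

/-! ## Grünwald–Letnikov weights -/

lemma glWeight_zero (α : ℝ) : glWeight α 0 = 1 := by simp [glWeight]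

lemma glWeight_recurrence (α : ℝ) (k : ℕ) :
    ((k : ℝ) + 1) * glWeight α (k + 1) = (k - α) * glWeight α k := by
  have h := Ring.choose_smul_choose α (Nat.le_succ k)
  rw [Nat.succ_eq_add_one, Nat.choose_succ_self_right, Nat.add_sub_cancel_left,
    Ring.choose_one_right, nsmul_eq_mul] at h
  push_cast at h
  rw [glWeight, glWeight, pow_succ]
  linear_combination (-1) ^ k * (-1) * h

/-- Partial sums of the Grünwald–Letnikov weights. -/
def glSum (α : ℝ) (n : ℕ) : ℝ := ∑ k ∈ Finset.range (n + 1), glWeight α k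

lemma glSum_zero (α : ℝ) : glSum α 0 = 1 := by simp [glSum, glWeight_zero]

lemma glSum_succ (α : ℝ) (n : ℕ) : glSum α (n + 1) = glSum α n + glWeight α (n + 1) := by
  rw [glSum, Finset.sum_range_succ, glSum]

lemma succ_mul_glWeight_succ (α : ℝ) (n : ℕ) :
    ((n : ℝ) + 1) * glWeight α (n + 1) = -α * glSum α n := by
  induction n with
  | zero =>
    have := glWeight_recurrence α 0
    simp only [Nat.cast_zero, glWeight_zero, glSum_zero] at this ⊢
    linarith
  | succ n ih =>
    have := glWeight_recurrence α (n + 1)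
    rw [glSum_succ]
    push_cast at this ⊢
    linear_combination this + ih

lemma glSum_recurrence (α : ℝ) (n : ℕ) :
    glSum α (n + 1) = glSum α n * (1 - α / ((n : ℝ) + 1)) := by
  have h := succ_mul_glWeight_succ α n
  have hn : (n : ℝ) + 1 ≠ 0 := by positivity
  rw [glSum_succ]
  field_simp
  linear_combination h

lemma glSum_bounds {α : ℝ} (hα0 : 0 < α) (hα1 : α < 1) (n : ℕ) :
    0 < glSum α n ∧ glSum α n ≤ ((n : ℝ) + 1) ^ (-α) := by
  induction n with
  | zero => simp [glSum_zero]
  | succ n ih =>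
    obtain ⟨h0, h1⟩ := ih
    have hn : (0 : ℝ) < (n : ℝ) + 1 := by positivity
    have hlt : α / ((n : ℝ) + 1) < 1 := by
      rw [div_lt_one hn]
      linarith [(Nat.cast_nonneg n : (0 : ℝ) ≤ n)]
    rw [glSum_recurrence]
    refine ⟨mul_pos h0 (by linarith), ?_⟩
    have hb := rpow_one_add_le_one_add_mul_self (s := 1 / ((n : ℝ) + 1))
      (by have : 0 < 1 / ((n : ℝ) + 1) := by positivity
          linarith) hα0.le hα1.le
    set t : ℝ := α / ((n : ℝ) + 1) with ht
    have ht0 : 0 < t := by positivity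
    have hb' : (1 + 1 / ((n : ℝ) + 1)) ^ α ≤ 1 + t := by
      refine hb.trans_eq ?_
      rw [ht]; ring
    have hle : 1 - t ≤ (1 + 1 / ((n : ℝ) + 1)) ^ (-α) := by
      rw [Real.rpow_neg (by positivity), ← one_div, le_div_iff₀ (by positivity)]
      have := mul_le_mul_of_nonneg_left hb' (by linarith : 0 ≤ 1 - t)
      nlinarith
    calc glSum α n * (1 - t) ≤ ((n : ℝ) + 1) ^ (-α) * (1 + 1 / ((n : ℝ) + 1)) ^ (-α) :=
          mul_le_mul h1 hle (by linarith) (by positivity)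
      _ = (((n + 1 : ℕ) : ℝ) + 1) ^ (-α) := by
          rw [← Real.mul_rpow hn.le (by positivity)]
          congr 1
          field_simp
          push_cast
          ring

lemma abs_glWeight_succ_le {α : ℝ} (hα0 : 0 < α) (hα1 : α < 1) (n : ℕ) :
    |glWeight α (n + 1)| ≤ ((n : ℝ) + 1) ^ (-(1 + α)) := by
  have hn : (0 : ℝ) < (n : ℝ) + 1 := by positivity
  obtain ⟨h0, h1⟩ := glSum_bounds hα0 hα1 n
  have h := succ_mul_glWeight_succ α n
  have he : |glWeight α (n + 1)| = α * glSum α n / ((n : ℝ) + 1) := by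
    have : glWeight α (n + 1) = -(α * glSum α n / ((n : ℝ) + 1)) := by
      field_simp; linarith
    rw [this, abs_neg, abs_of_pos (by positivity)]
  rw [he, neg_add, Real.rpow_add hn, Real.rpow_neg_one, div_eq_inv_mul]
  refine mul_le_mul_of_nonneg_left ?_ (by positivity)
  nlinarith

lemma abs_glWeight_le {α : ℝ} (hα0 : 0 < α) (hα1 : α < 1) (n : ℕ) :
    |glWeight α n| ≤ 4 * ((n : ℝ) + 1) ^ (-(1 + α)) := by
  cases n with
  | zero => norm_num [glWeight_zero]
  | succ n =>
    refine (abs_glWeight_succ_le hα0 hα1 n).trans ?_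
    have hn : (0 : ℝ) < (n : ℝ) + 1 := by positivity
    push_cast
    calc ((n : ℝ) + 1) ^ (-(1 + α)) ≤ (((n : ℝ) + 1 + 1) / 2) ^ (-(1 + α)) :=
          Real.rpow_le_rpow_of_nonpos (by positivity)
            (by linarith [(Nat.cast_nonneg n : (0 : ℝ) ≤ n)]) (by linarith)
      _ = 2 ^ (1 + α) * ((n : ℝ) + 1 + 1) ^ (-(1 + α)) := by
          rw [Real.div_rpow (by positivity) (by norm_num),
            Real.rpow_neg (by norm_num : (0 : ℝ) ≤ 2), div_inv_eq_mul, mul_comm]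
      _ ≤ 4 * ((n : ℝ) + 1 + 1) ^ (-(1 + α)) := by
          refine mul_le_mul_of_nonneg_right ?_ (by positivity)
          calc (2 : ℝ) ^ (1 + α) ≤ 2 ^ (2 : ℝ) :=
                Real.rpow_le_rpow_of_exponent_le one_le_two (by linarith)
            _ = 4 := by norm_num

lemma abs_glWeight_le_one {α : ℝ} (hα0 : 0 < α) (hα1 : α < 1) (n : ℕ) : |glWeight α n| ≤ 1 := by
  cases n with
  | zero => norm_num [glWeight_zero]
  | succ n =>
    exact (abs_glWeight_succ_le hα0 hα1 n).trans
      (Real.rpow_le_one_of_one_le_of_nonpos (by linarith [(Nat.cast_nonneg n : (0 : ℝ) ≤ n)])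
        (by linarith))

/-! ## Second order BDF weights -/

/-- The second order BDF weights divided by `(3/2) ^ α`. -/
def bdf2Coeff (α : ℝ) (j : ℕ) : ℝ :=
  ∑ l ∈ Finset.range (j + 1), (1 / 3 : ℝ) ^ l * glWeight α l * glWeight α (j - l)

lemma bdf2Weight_eq (α : ℝ) (j : ℕ) : bdf2Weight α j = (3 / 2 : ℝ) ^ α * bdf2Coeff α j := rfl

section Recurrence

open PowerSeries

lemma one_sub_X_mul_derivative_mk_glWeight (α r : ℝ) :
    (1 - C r * X) * derivative ℝ (mk fun k => r ^ k * glWeight α k) =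
      C (-(α * r)) * mk fun k => r ^ k * glWeight α k := by
  ext n
  rw [sub_mul, one_mul, mul_assoc, map_sub, coeff_C_mul, coeff_C_mul, coeff_derivative, coeff_mk,
    coeff_mk]
  have h := glWeight_recurrence α n
  cases n with
  | zero =>
    simp only [coeff_zero_X_mul, Nat.cast_zero] at h ⊢
    linear_combination r * h
  | succ n =>
    rw [coeff_succ_X_mul, coeff_derivative, coeff_mk]
    push_cast at h ⊢
    linear_combination r ^ (n + 2) * h

lemma bdf2Coeff_recurrence (α : ℝ) (j : ℕ) :
    3 * ((j : ℝ) + 3) * bdf2Coeff α (j + 3) =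
      4 * ((j : ℝ) + 2 - α) * bdf2Coeff α (j + 2) -
        ((j : ℝ) + 1 - 2 * α) * bdf2Coeff α (j + 1) := by
  set g : PowerSeries ℝ := mk fun k => (1 : ℝ) ^ k * glWeight α k with hg
  set f : PowerSeries ℝ := mk fun k => (1 / 3 : ℝ) ^ k * glWeight α k with hf
  have hc : ∀ n, coeff n (f * g) = bdf2Coeff α n := by
    intro n
    rw [coeff_mul, Finset.Nat.sum_antidiagonal_eq_sum_range_succ
      (fun i k => coeff i f * coeff k g), bdf2Coeff]
    refine Finset.sum_congr rfl fun l _ => ?_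
    rw [hf, hg, coeff_mk, coeff_mk, one_pow, one_mul]
  have h1 := one_sub_X_mul_derivative_mk_glWeight α 1
  have h3 := one_sub_X_mul_derivative_mk_glWeight α (1 / 3)
  rw [← hg] at h1
  rw [← hf] at h3
  have hD : (1 - C (4 / 3 : ℝ) * X + C (1 / 3 : ℝ) * (X * X)) * derivative ℝ (f * g) =
      (C (-(4 / 3) * α) + C (2 / 3 * α) * X) * (f * g) := by
    have e1 : (C (4 / 3 : ℝ) : PowerSeries ℝ) = 1 + C (1 / 3 : ℝ) := by
      rw [← map_one (C (R := ℝ)), ← map_add]; norm_num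
    have e2 : (C (-(4 / 3) * α) : PowerSeries ℝ) = C (-(α * 1)) + C (-(α * (1 / 3))) := by
      rw [← map_add]; congr 1; ring
    have e3 : (C (2 / 3 * α) : PowerSeries ℝ) =
        -(C (-(α * 1)) * C (1 / 3 : ℝ)) - C (-(α * (1 / 3))) := by
      rw [← map_mul, ← map_neg, ← map_sub]; congr 1; ring
    have e4 : (C (1 : ℝ) : PowerSeries ℝ) = 1 := map_one _
    rw [Derivation.leibniz, smul_eq_mul, smul_eq_mul, e1, e2, e3]
    rw [e4] at h1
    linear_combination (1 - C (1 / 3 : ℝ) * X) * f * h1 + (1 - X) * g * h3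
  have h := congrArg (coeff (j + 2)) hD
  rw [add_mul, sub_mul, one_mul, add_mul, mul_assoc, mul_assoc, mul_assoc, mul_assoc] at h
  simp only [map_add, map_sub, coeff_C_mul, coeff_succ_X_mul, coeff_derivative, hc] at h
  push_cast at h
  linear_combination 3 * h

end Recurrence

lemma bdf2Coeff_zero (α : ℝ) : bdf2Coeff α 0 = 1 := by simp [bdf2Coeff, glWeight_zero]

lemma glWeight_one (α : ℝ) : glWeight α 1 = -α := by
  have := glWeight_recurrence α 0
  simp only [glWeight_zero, Nat.cast_zero, zero_add] at this
  linarith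

lemma glWeight_two (α : ℝ) : glWeight α 2 = -(α * (1 - α)) / 2 := by
  have := glWeight_recurrence α 1
  simp only [glWeight_one, Nat.cast_one, show 1 + 1 = 2 from rfl] at this
  linarith

lemma glWeight_three (α : ℝ) : glWeight α 3 = -(α * (1 - α) * (2 - α)) / 6 := by
  have := glWeight_recurrence α 2
  simp only [glWeight_two, Nat.cast_ofNat, show 2 + 1 = 3 from rfl] at this
  linarith

lemma bdf2Coeff_one (α : ℝ) : bdf2Coeff α 1 = -(4 / 3) * α := by
  simp [bdf2Coeff, Finset.sum_range_succ, glWeight_zero, glWeight_one]; ring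

lemma bdf2Coeff_two (α : ℝ) : bdf2Coeff α 2 = α * (8 * α - 5) / 9 := by
  simp [bdf2Coeff, Finset.sum_range_succ, glWeight_zero, glWeight_one, glWeight_two]; ring

lemma bdf2Coeff_three (α : ℝ) : bdf2Coeff α 3 = α * (1 - α) * (32 * α - 28) / 81 := by
  simp [bdf2Coeff, Finset.sum_range_succ, glWeight_zero, glWeight_one, glWeight_two,
    glWeight_three]; ring

lemma bdf2Coeff_four (α : ℝ) :
    bdf2Coeff α 4 = α * (1 - α) * (-128 * α ^ 2 + 352 * α - 246) / 972 := by
  have h := bdf2Coeff_recurrence α 1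
  simp only [bdf2Coeff_two, bdf2Coeff_three, Nat.cast_one, show 1 + 3 = 4 from rfl,
    show 1 + 2 = 3 from rfl, show 1 + 1 = 2 from rfl] at h
  linarith

lemma bdf2Coeff_nonpos {α : ℝ} (hα0 : 0 < α) (hα1 : α < 1) (j : ℕ) (hj : 4 ≤ j) :
    bdf2Coeff α j ≤ 0 := by
  have hpos : 0 < α * (1 - α) := mul_pos hα0 (by linarith)
  suffices h : bdf2Coeff α j ≤ 0 ∧ bdf2Coeff α j ≤ bdf2Coeff α (j - 1) / 2 from h.1
  induction j, hj using Nat.le_induction with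
  | base =>
    simp only [show 4 - 1 = 3 from rfl, bdf2Coeff_three, bdf2Coeff_four]
    constructor
    · nlinarith [sq_nonneg (1 - α)]
    · nlinarith [sq_nonneg (α - 5 / 8)]
  | succ j hj ih =>
    obtain ⟨i, rfl⟩ : ∃ i, j = i + 2 := ⟨j - 2, by omega⟩
    obtain ⟨h0, h1⟩ := ih
    have hr := bdf2Coeff_recurrence α i
    have hi : (2 : ℝ) ≤ i := by exact_mod_cast (by omega : 2 ≤ i)
    simp only [show i + 2 - 1 = i + 1 by omega, show i + 2 + 1 = i + 3 by omega,
      show i + 3 - 1 = i + 2 by omega] at h1 ⊢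
    have h2 : ((i : ℝ) + 1 - 2 * α) * (2 * bdf2Coeff α (i + 2)) ≤
        ((i : ℝ) + 1 - 2 * α) * bdf2Coeff α (i + 1) :=
      mul_le_mul_of_nonneg_left (by linarith) (by linarith)
    have h3 : ((i : ℝ) + 3) * (3 * bdf2Coeff α (i + 3)) ≤
        ((i : ℝ) + 3) * (2 * bdf2Coeff α (i + 2)) := by nlinarith
    have h4 := le_of_mul_le_mul_left h3 (by linarith)
    constructor <;> linarith

lemma sum_bdf2Coeff (α : ℝ) (n : ℕ) : ∑ j ∈ Finset.range (n + 1), bdf2Coeff α j =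
    ∑ l ∈ Finset.range (n + 1), (1 / 3 : ℝ) ^ l * glWeight α l * glSum α (n - l) := by
  induction n with
  | zero => simp [bdf2Coeff_zero, glWeight_zero, glSum_zero]
  | succ n ih =>
    rw [Finset.sum_range_succ, ih, Finset.sum_range_succ _ (n + 1), bdf2Coeff,
      Finset.sum_range_succ _ (n + 1), Nat.sub_self, glWeight_zero, glSum_zero, ← add_assoc,
      ← Finset.sum_add_distrib]
    congr 1
    refine Finset.sum_congr rfl fun l hl => ?_
    have hl' : l < n + 1 := Finset.mem_range.mp hl
    rw [show n + 1 - l = n - l + 1 by omega, glSum_succ]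
    ring

lemma exists_abs_sum_bdf2Coeff_le {α : ℝ} (hα0 : 0 < α) (hα1 : α < 1) :
    ∃ K : ℝ, ∀ n : ℕ, |∑ j ∈ Finset.range (n + 1), bdf2Coeff α j| ≤
      K * ((n : ℝ) + 1) ^ (-α) := by
  obtain ⟨S, -, hb⟩ := exists_geometric_conv_rpow_le (r := 1 / 3) (by norm_num) (by norm_num)
    hα0.le (by linarith)
  refine ⟨S, fun n => ?_⟩
  rw [sum_bdf2Coeff]
  refine (Finset.abs_sum_le_sum_abs _ _).trans (le_trans ?_ (hb n))
  refine Finset.sum_le_sum fun l _ => ?_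
  obtain ⟨h0, h1⟩ := glSum_bounds hα0 hα1 (n - l)
  rw [abs_mul, abs_mul, abs_of_pos h0, abs_of_nonneg (by positivity : (0 : ℝ) ≤ (1 / 3) ^ l)]
  refine mul_le_mul ?_ h1 h0.le (by positivity)
  exact mul_le_of_le_one_right (by positivity) (abs_glWeight_le_one hα0 hα1 l)

lemma exists_abs_bdf2Coeff_le {α : ℝ} (hα0 : 0 < α) (hα1 : α < 1) :
    ∃ K : ℝ, ∀ j : ℕ, |bdf2Coeff α j| ≤ K * ((j : ℝ) + 1) ^ (-(1 + α)) := by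
  obtain ⟨S, -, hb⟩ := exists_geometric_conv_rpow_le (r := 1 / 3) (p := 1 + α) (by norm_num)
    (by norm_num) (by linarith) (by linarith)
  refine ⟨4 * S, fun n => ?_⟩
  rw [bdf2Coeff, mul_assoc]
  refine (Finset.abs_sum_le_sum_abs _ _).trans
    (le_trans ?_ (mul_le_mul_of_nonneg_left (hb n) (by norm_num)))
  rw [Finset.mul_sum]
  refine Finset.sum_le_sum fun l _ => ?_
  rw [abs_mul, abs_mul, abs_of_nonneg (by positivity : (0 : ℝ) ≤ (1 / 3) ^ l)]
  have h1 := abs_glWeight_le hα0 hα1 (n - l)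
  have h2 : (1 / 3 : ℝ) ^ l * |glWeight α l| ≤ (1 / 3 : ℝ) ^ l :=
    mul_le_of_le_one_right (by positivity) (abs_glWeight_le_one hα0 hα1 l)
  calc _ ≤ (1 / 3 : ℝ) ^ l * (4 * (((n - l : ℕ) : ℝ) + 1) ^ (-(1 + α))) :=
        mul_le_mul h2 h1 (abs_nonneg _) (by positivity)
    _ = _ := by ring

lemma sum_bdf2Coeff_nonneg {α : ℝ} (hα0 : 0 < α) (hα1 : α < 1) (n : ℕ) (hn : 2 ≤ n) :
    0 ≤ ∑ j ∈ Finset.range (n + 1), bdf2Coeff α j := by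
  rcases Nat.eq_or_lt_of_le hn with h | h
  · subst h
    simp only [Finset.sum_range_succ, Finset.sum_range_zero, bdf2Coeff_zero, bdf2Coeff_one,
      bdf2Coeff_two]
    nlinarith
  obtain ⟨K, hK⟩ := exists_abs_sum_bdf2Coeff_le hα0 hα1
  have hlim : Filter.Tendsto (fun n : ℕ => ∑ j ∈ Finset.range (n + 1), bdf2Coeff α j)
      Filter.atTop (nhds 0) := by
    refine squeeze_zero_norm hK ?_
    have h1 : Filter.Tendsto (fun n : ℕ => (n : ℝ) + 1) Filter.atTop Filter.atTop :=
      Filter.tendsto_atTop_add_const_right _ _ tendsto_natCast_atTop_atTop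
    simpa using ((tendsto_rpow_neg_atTop hα0).comp h1).const_mul K
  refine le_of_tendsto hlim (Filter.eventually_atTop.mpr ⟨n, fun m hm => ?_⟩)
  induction m, hm using Nat.le_induction with
  | base => exact le_rfl
  | succ m hm ih =>
    rw [Finset.sum_range_succ]
    linarith [bdf2Coeff_nonpos hα0 hα1 (m + 1) (by omega)]

lemma exists_isAsymptoticKernel_bdf2 {α : ℝ} (hα0 : 0 < α) (hα1 : α < 1) :
    ∃ K : ℝ, IsAsymptoticKernel (fun n j => ((3 / 2 : ℝ) ^ α)⁻¹ * bdf2SchemeWeight α n j)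
      (bdf2Coeff α) α K := by
  obtain ⟨K, hK⟩ := exists_abs_sum_bdf2Coeff_le hα0 hα1
  have hm : ((3 / 2 : ℝ) ^ α) ≠ 0 := by positivity
  have hw : ∀ n j, ((3 / 2 : ℝ) ^ α)⁻¹ * bdf2SchemeWeight α n j =
      if j < n then bdf2Coeff α j else -∑ i ∈ Finset.range n, bdf2Coeff α i := by
    intro n j
    rw [bdf2SchemeWeight]
    simp only [bdf2Weight_eq, ← Finset.mul_sum]
    split_ifs
    · field_simp
    · field_simp
  have hK0 : 0 ≤ K := by simpa using (abs_nonneg _).trans (hK 0)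
  refine ⟨K, ?_, ?_, fun n j hj => ?_, fun n hn => ?_, fun n hn => ?_⟩
  · simp [hw, bdf2Coeff_zero]
  · simp [hw]
  · rw [hw, if_pos (by omega)]
  · rw [hw, if_pos (by omega), sub_self, abs_zero]
    positivity
  · rw [hw, if_neg (lt_irrefl n), abs_neg]
    obtain ⟨m, rfl⟩ : ∃ m, n = m + 1 := ⟨n - 1, by omega⟩
    simpa using hK m

theorem forcedDecay_bdf2 {α H b : ℝ} (hα0 : 0 < α) (hα1 : α < 1) (hH : 0 < H) (hb : 0 < b)
    (hcond : 2 * bdf2Weight α 2 + 2 * bdf2Weight α 3 ≤ H * b) :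
    ForcedDecay (bdf2SchemeWeight α) α 5 H b := by
  refine ForcedDecay.of_scaled ((3 / 2 : ℝ) ^ α) ?_
  set m : ℝ := (3 / 2 : ℝ) ^ α with hm
  have hm0 : 0 < m := by positivity
  obtain ⟨K, hw⟩ := exists_isAsymptoticKernel_bdf2 hα0 hα1
  obtain ⟨K', hK'⟩ := exists_abs_bdf2Coeff_le hα0 hα1
  have hH' : 0 < m⁻¹ * H := by positivity
  have hB0 : 0 < m⁻¹ * H * b := by positivity
  have hB : 2 * bdf2Coeff α 2 + 2 * bdf2Coeff α 3 ≤ m⁻¹ * H * b := by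
    rw [bdf2Weight_eq, bdf2Weight_eq, ← hm] at hcond
    rw [mul_assoc, le_inv_mul_iff₀ hm0]
    linarith
  have hα' : 0 < 1 - α := by linarith
  have hsum := sum_bdf2Coeff_nonneg hα0 hα1
  have hneg := bdf2Coeff_nonpos hα0 hα1
  set B : ℝ := m⁻¹ * H * b with hBdef
  have e0 := bdf2Coeff_zero α
  have e1 := bdf2Coeff_one α
  have e2 := bdf2Coeff_two α
  have e3 := bdf2Coeff_three α
  have hsum' : α ≤ 33 / 50 → ∀ n, 0 ≤ ∑ j ∈ Finset.range (n + 1), bdf2Coeff α j := by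
    intro h n
    rcases Nat.lt_or_ge n 2 with hn | hn
    · interval_cases n
      · simp [e0]
      · simp only [Finset.sum_range_succ, Finset.sum_range_zero, e0, e1]
        linarith
    · exact hsum n hn
  have hneg3 : α ≤ 7 / 8 → bdf2Coeff α 3 ≤ 0 := by
    intro h
    rw [e3]
    have := mul_nonneg (mul_pos hα0 hα').le (by linarith : 0 ≤ 28 - 32 * α)
    linarith
  have hneg3' : α ≤ 7 / 8 → ∀ j, 3 ≤ j → bdf2Coeff α j ≤ 0 := by
    intro h j hj
    rcases Nat.eq_or_lt_of_le hj with rfl | hj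
    · exact hneg3 h
    · exact hneg j hj
  rcases le_or_gt α (5 / 8) with h58 | h58
  · refine forcedDecay_of_nonpos hα0 hα1 hH' hb hw (fun j hj => ?_) (hsum' (by linarith)) hK'
    rcases Nat.lt_or_ge j 3 with h | h
    · interval_cases j
      · rw [e1]; linarith
      · rw [e2]
        have := mul_nonneg hα0.le (by linarith : 0 ≤ 5 - 8 * α)
        linarith
    · exact hneg3' (by linarith) j h
  have h2pos : 0 < bdf2Coeff α 2 := by
    rw [e2]
    have := mul_pos hα0 (by linarith : 0 < 8 * α - 5)
    linarith
  by_cases hsmall : α ≤ 33 / 50 ∧ B ≤ 1 / 2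
  · obtain ⟨h66, hB2⟩ := hsmall
    have hv2 : bdf2Coeff α 2 ≤ 21 / 1000 := by rw [e2]; nlinarith
    refine forcedDecay_of_geometricKernel (r := 1 / 10) (κ := 1 / 5) hα0 hα1 hH' hb hw
      (by norm_num) (by norm_num) (by norm_num) ?_ ?_ (hneg3' (by linarith)) (hsum' h66) ?_ ?_ hK'
    all_goals rw [← hBdef]
    · rw [e0, e1]; linarith
    · rw [e0, e1]; linarith
    · rw [max_eq_left h2pos.le, e0, e1]; linarith
    · rw [max_eq_left h2pos.le, e0, e1]; linarith
  · have h12 : bdf2Coeff α 1 + bdf2Coeff α 2 = -(α * (17 - 8 * α) / 9) := by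
      rw [e1, e2]; ring
    have hT : 0 < α * (17 - 8 * α) := mul_pos hα0 (by linarith)
    have hcore : (8 * α - 5) ^ 2 ≤ B * (24 * (11 - 8 * α)) ∧ 16 * max (bdf2Coeff α 3) 0 ≤ B := by
      rcases le_or_gt α (33 / 50) with h66 | h66
      · have hB2 : 1 / 2 < B := by
          by_contra! h
          exact hsmall ⟨h66, h⟩
        constructor
        · nlinarith
        · rw [max_eq_right (hneg3 (by linarith))]; linarith
      · have hq : (8 * α - 5) ^ 2 ≤ -32 * α ^ 2 + 132 * α - 73 := by nlinarith
        have hBq : 2 * α * (-32 * α ^ 2 + 132 * α - 73) ≤ 81 * B := by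
          rw [e2, e3] at hB
          linarith
        set q : ℝ := -32 * α ^ 2 + 132 * α - 73 with hqdef
        have hq0 : 0 ≤ q := (sq_nonneg _).trans hq
        constructor
        · have h1 : 81 ≤ 2 * α * (24 * (11 - 8 * α)) := by nlinarith
          have h2 := mul_le_mul_of_nonneg_right hBq (by linarith : 0 ≤ 24 * (11 - 8 * α))
          have h3 := mul_le_mul_of_nonneg_left h1 hq0
          linarith
        · rcases le_total α (7 / 8) with h | h
          · rw [max_eq_right (hneg3 h)]; linarith
          · have h3 : bdf2Coeff α 3 ≤ α * q / 648 := by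
              rw [e3]
              have h4 : 8 * ((1 - α) * (32 * α - 28)) ≤ q := by rw [hqdef]; nlinarith
              have := mul_le_mul_of_nonneg_left h4 hα0.le
              linarith
            have h5 : 0 ≤ α * q := mul_nonneg hα0.le hq0
            have h6 : max (bdf2Coeff α 3) 0 ≤ α * q / 648 := max_le h3 (by linarith)
            linarith
    refine forcedDecay_of_shiftedKernel hα0 hα1 hH' hb hw (by rw [h12]; linarith) h2pos hcore.2
      hneg hsum ?_ hK'
    rw [h12, e0, e2, ← hBdef]
    have h7 := mul_le_mul_of_nonneg_left hcore.1 (by positivity : 0 ≤ α ^ 2 / 81)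
    linarith

/-! ## Moments of the Caputo kernel on unit intervals -/

/-- `(1 - α) ∫_m^{m+1} σ^{-α} dσ`. -/
def caputoMean (α : ℝ) (m : ℕ) : ℝ := (1 - α) * ∫ t in (0 : ℝ)..1, ((m : ℝ) + t) ^ (-α)

/-- `(1 - α) ∫_m^{m+1} σ^{-α} (m + 1/2 - σ) dσ`. -/
def caputoMoment (α : ℝ) (m : ℕ) : ℝ :=
  (1 - α) * ∫ t in (0 : ℝ)..1, ((m : ℝ) + t) ^ (-α) * (1 / 2 - t)

lemma intervalIntegrable_add_rpow_neg {α : ℝ} (hα1 : α < 1) (m : ℕ) :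
    IntervalIntegrable (fun t : ℝ => ((m : ℝ) + t) ^ (-α)) MeasureTheory.volume 0 1 := by
  have h := intervalIntegral.intervalIntegrable_rpow' (a := (m : ℝ)) (b := m + 1)
    (by linarith : -1 < -α)
  simpa using h.comp_add_left (m : ℝ)

lemma IntervalIntegrable.mul_half_sub {ψ : ℝ → ℝ}
    (hψ : IntervalIntegrable ψ MeasureTheory.volume 0 1) :
    IntervalIntegrable (fun t => ψ t * (1 / 2 - t)) MeasureTheory.volume 0 1 :=
  hψ.mul_continuousOn (by fun_prop)

lemma integral_mul_half_sub_nonneg {ψ : ℝ → ℝ}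
    (hψ : IntervalIntegrable ψ MeasureTheory.volume 0 1) (ha : AntitoneOn ψ (Set.Ioo 0 1)) :
    0 ≤ ∫ t in (0 : ℝ)..1, ψ t * (1 / 2 - t) := by
  have h0 : ∫ t in (0 : ℝ)..1, ψ (1 / 2) * (1 / 2 - t) = 0 := by
    rw [intervalIntegral.integral_const_mul, intervalIntegral.integral_sub (by simp) (by simp),
      integral_id, intervalIntegral.integral_const]
    norm_num
  have hc : IntervalIntegrable (fun t => ψ (1 / 2) * (1 / 2 - t)) MeasureTheory.volume 0 1 :=
    Continuous.intervalIntegrable (by fun_prop) _ _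
  refine h0.ge.trans ?_
  refine intervalIntegral.integral_mono_on_of_le_Ioo zero_le_one hc hψ.mul_half_sub fun t ht => ?_
  have hh : (1 / 2 : ℝ) ∈ Set.Ioo (0 : ℝ) 1 := by norm_num
  rcases le_total t (1 / 2) with h | h
  · exact mul_le_mul_of_nonneg_right (ha ht hh h) (by linarith)
  · exact mul_le_mul_of_nonpos_right (ha hh ht h) (by linarith)

lemma integral_mul_half_sub_le {ψ : ℝ → ℝ}
    (hψ : IntervalIntegrable ψ MeasureTheory.volume 0 1) (h0 : ∀ t ∈ Set.Ioo (0 : ℝ) 1, 0 ≤ ψ t) :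
    ∫ t in (0 : ℝ)..1, ψ t * (1 / 2 - t) ≤ (∫ t in (0 : ℝ)..1, ψ t) / 2 := by
  have he : (∫ t in (0 : ℝ)..1, ψ t) / 2 = ∫ t in (0 : ℝ)..1, ψ t * 2⁻¹ := by
    rw [intervalIntegral.integral_mul_const]; rfl
  rw [he]
  refine intervalIntegral.integral_mono_on_of_le_Ioo zero_le_one
    hψ.mul_half_sub (hψ.mul_const _) fun t ht => ?_
  exact mul_le_mul_of_nonneg_left (by linarith [ht.1]) (h0 t ht)

lemma antitoneOn_add_rpow_neg {α : ℝ} (hα0 : 0 < α) (m : ℕ) :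
    AntitoneOn (fun t : ℝ => ((m : ℝ) + t) ^ (-α)) (Set.Ioo 0 1) := by
  intro s hs t _ hst
  have hs0 := hs.1
  exact Real.rpow_le_rpow_of_nonpos (by positivity) (by linarith) (by linarith)

lemma rpow_neg_sub_rpow_neg_eq {α x : ℝ} (hx : 0 < x) :
    x ^ (-α) - (x + 1) ^ (-α) = x ^ (-α) * (1 - (x / (x + 1)) ^ α) := by
  rw [Real.div_rpow hx.le (by positivity), Real.rpow_neg hx.le, Real.rpow_neg (by positivity)]
  field_simp

lemma rpow_neg_sub_rpow_neg_nonneg {α x : ℝ} (hα0 : 0 < α) (hx : 0 < x) :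
    0 ≤ x ^ (-α) - (x + 1) ^ (-α) :=
  sub_nonneg.mpr (Real.rpow_le_rpow_of_nonpos hx (by linarith) (by linarith))

lemma rpow_neg_sub_rpow_neg_antitone {α x y : ℝ} (hα0 : 0 < α) (hx : 0 < x) (hxy : x ≤ y) :
    y ^ (-α) - (y + 1) ^ (-α) ≤ x ^ (-α) - (x + 1) ^ (-α) := by
  have hy : 0 < y := hx.trans_le hxy
  rw [rpow_neg_sub_rpow_neg_eq hx, rpow_neg_sub_rpow_neg_eq hy]
  refine mul_le_mul (Real.rpow_le_rpow_of_nonpos hx hxy (by linarith)) ?_ ?_ (by positivity)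
  · have : (x / (x + 1)) ^ α ≤ (y / (y + 1)) ^ α := by
      refine Real.rpow_le_rpow (by positivity) ?_ hα0.le
      rw [div_le_div_iff₀ (by positivity) (by positivity)]
      linarith
    linarith
  · have : (y / (y + 1)) ^ α ≤ 1 :=
      Real.rpow_le_one (by positivity) ((div_le_one (by positivity)).mpr (by linarith)) hα0.le
    linarith

lemma rpow_neg_sub_rpow_neg_le {α x : ℝ} (hα1 : α < 1) (hx : 0 < x) :
    x ^ (-α) - (x + 1) ^ (-α) ≤ x ^ (-(1 + α)) := by
  rw [rpow_neg_sub_rpow_neg_eq hx, show -(1 + α) = -α + -1 by ring, Real.rpow_add hx, Real.rpow_neg_one]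
  refine mul_le_mul_of_nonneg_left ?_ (by positivity)
  have h1 : x / (x + 1) ≤ (x / (x + 1)) ^ α := by
    have := Real.rpow_le_rpow_of_exponent_ge (by positivity : 0 < x / (x + 1))
      ((div_le_one (by positivity)).mpr (by linarith)) hα1.le
    rwa [Real.rpow_one] at this
  have h2 : 1 - x / (x + 1) = (x + 1)⁻¹ := by field_simp; ring
  have h3 : (x + 1)⁻¹ ≤ x⁻¹ := inv_anti₀ hx (by linarith)
  linarith

lemma caputoMean_nonneg {α : ℝ} (hα1 : α < 1) (m : ℕ) : 0 ≤ caputoMean α m := by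
  refine mul_nonneg (by linarith) ?_
  rw [intervalIntegral.integral_of_le zero_le_one]
  refine MeasureTheory.setIntegral_nonneg measurableSet_Ioc fun t ht => ?_
  have ht0 := ht.1
  positivity

lemma caputoMoment_nonneg {α : ℝ} (hα0 : 0 < α) (hα1 : α < 1) (m : ℕ) : 0 ≤ caputoMoment α m :=
  mul_nonneg (by linarith) (integral_mul_half_sub_nonneg (intervalIntegrable_add_rpow_neg hα1 m)
    (antitoneOn_add_rpow_neg hα0 m))

lemma caputoMoment_le {α : ℝ} (hα1 : α < 1) (m : ℕ) :
    caputoMoment α m ≤ caputoMean α m / 2 := by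
  have h := integral_mul_half_sub_le (intervalIntegrable_add_rpow_neg hα1 m) fun t ht => by
    have := ht.1
    positivity
  have := mul_le_mul_of_nonneg_left h (by linarith : 0 ≤ 1 - α)
  rw [caputoMoment, caputoMean]
  linarith

lemma caputoMean_sub_succ {α : ℝ} (hα1 : α < 1) (m : ℕ) :
    caputoMean α m - caputoMean α (m + 1) =
      (1 - α) * ∫ t in (0 : ℝ)..1, (((m : ℝ) + t) ^ (-α) - ((m : ℝ) + t + 1) ^ (-α)) := by
  have h1 := intervalIntegrable_add_rpow_neg hα1 (m + 1)
  have e : ∀ t : ℝ, ((m + 1 : ℕ) : ℝ) + t = (m : ℝ) + t + 1 := fun t => by push_cast; ring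
  simp only [e] at h1
  rw [intervalIntegral.integral_sub (intervalIntegrable_add_rpow_neg hα1 m) h1, caputoMean,
    caputoMean]
  simp only [e]
  ring

lemma caputoMoment_sub_succ {α : ℝ} (hα1 : α < 1) (m : ℕ) :
    caputoMoment α m - caputoMoment α (m + 1) =
      (1 - α) * ∫ t in (0 : ℝ)..1,
        (((m : ℝ) + t) ^ (-α) - ((m : ℝ) + t + 1) ^ (-α)) * (1 / 2 - t) := by
  have h1 := intervalIntegrable_add_rpow_neg hα1 (m + 1)
  have e : ∀ t : ℝ, ((m + 1 : ℕ) : ℝ) + t = (m : ℝ) + t + 1 := fun t => by push_cast; ring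
  simp only [e] at h1
  simp only [sub_mul]
  rw [intervalIntegral.integral_sub (intervalIntegrable_add_rpow_neg hα1 m).mul_half_sub
    h1.mul_half_sub, caputoMoment, caputoMoment]
  simp only [e]
  ring

lemma intervalIntegrable_rpow_neg_sub {α : ℝ} (hα1 : α < 1) (m : ℕ) :
    IntervalIntegrable (fun t : ℝ => ((m : ℝ) + t) ^ (-α) - ((m : ℝ) + t + 1) ^ (-α))
      MeasureTheory.volume 0 1 := by
  have h1 := intervalIntegrable_add_rpow_neg hα1 (m + 1)
  have e : ∀ t : ℝ, ((m + 1 : ℕ) : ℝ) + t = (m : ℝ) + t + 1 := fun t => by push_cast; ring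
  simp only [e] at h1
  exact (intervalIntegrable_add_rpow_neg hα1 m).sub h1

lemma caputoMoment_succ_le {α : ℝ} (hα0 : 0 < α) (hα1 : α < 1) (m : ℕ) :
    caputoMoment α (m + 1) ≤ caputoMoment α m := by
  rw [← sub_nonneg, caputoMoment_sub_succ hα1]
  refine mul_nonneg (by linarith) (integral_mul_half_sub_nonneg
    (intervalIntegrable_rpow_neg_sub hα1 m) fun s hs t _ hst => ?_)
  have hs0 := hs.1
  exact rpow_neg_sub_rpow_neg_antitone hα0 (by positivity) (by linarith)

lemma caputoMoment_sub_succ_le {α : ℝ} (hα0 : 0 < α) (hα1 : α < 1) (m : ℕ) :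
    caputoMoment α m - caputoMoment α (m + 1) ≤
      (caputoMean α m - caputoMean α (m + 1)) / 2 := by
  have h := integral_mul_half_sub_le (intervalIntegrable_rpow_neg_sub hα1 m) fun t ht => by
    have := ht.1
    exact rpow_neg_sub_rpow_neg_nonneg hα0 (by positivity)
  rw [caputoMoment_sub_succ hα1, caputoMean_sub_succ hα1]
  have := mul_le_mul_of_nonneg_left h (by linarith : 0 ≤ 1 - α)
  linarith

lemma caputoMean_succ_le {α : ℝ} (hα0 : 0 < α) (hα1 : α < 1) (m : ℕ) :
    caputoMean α (m + 1) ≤ caputoMean α m := by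
  rw [← sub_nonneg, caputoMean_sub_succ hα1]
  refine mul_nonneg (by linarith) ?_
  rw [intervalIntegral.integral_of_le zero_le_one]
  refine MeasureTheory.setIntegral_nonneg measurableSet_Ioc fun t ht => ?_
  have := ht.1
  exact rpow_neg_sub_rpow_neg_nonneg hα0 (by positivity)

lemma caputoMean_sub_succ_le {α : ℝ} (hα0 : 0 < α) (hα1 : α < 1) (m : ℕ) (hm : 1 ≤ m) :
    caputoMean α m - caputoMean α (m + 1) ≤ (m : ℝ) ^ (-(1 + α)) := by
  have hm0 : (0 : ℝ) < m := by exact_mod_cast hm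
  have hI : ∫ t in (0 : ℝ)..1, (((m : ℝ) + t) ^ (-α) - ((m : ℝ) + t + 1) ^ (-α)) ≤
      ∫ _ in (0 : ℝ)..1, (m : ℝ) ^ (-(1 + α)) := by
    refine intervalIntegral.integral_mono_on zero_le_one (intervalIntegrable_rpow_neg_sub hα1 m)
      (by simp) fun t ht => ?_
    have ht0 := ht.1
    exact (rpow_neg_sub_rpow_neg_le hα1 (by positivity)).trans
      (Real.rpow_le_rpow_of_nonpos hm0 (by linarith) (by linarith))
  rw [intervalIntegral.integral_const, sub_zero, one_smul] at hI
  rw [caputoMean_sub_succ hα1]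
  have h0 : 0 ≤ (m : ℝ) ^ (-(1 + α)) := by positivity
  calc _ ≤ (1 - α) * (m : ℝ) ^ (-(1 + α)) := mul_le_mul_of_nonneg_left hI (by linarith)
    _ ≤ _ := by nlinarith

lemma caputoMean_le {α : ℝ} (hα0 : 0 < α) (hα1 : α < 1) (m : ℕ) (hm : 1 ≤ m) :
    caputoMean α m ≤ (m : ℝ) ^ (-α) := by
  have hm0 : (0 : ℝ) < m := by exact_mod_cast hm
  have hI : ∫ t in (0 : ℝ)..1, ((m : ℝ) + t) ^ (-α) ≤ ∫ _ in (0 : ℝ)..1, (m : ℝ) ^ (-α) := by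
    refine intervalIntegral.integral_mono_on zero_le_one (intervalIntegrable_add_rpow_neg hα1 m)
      (by simp) fun t ht => ?_
    have ht0 := ht.1
    exact Real.rpow_le_rpow_of_nonpos hm0 (by linarith) (by linarith)
  rw [intervalIntegral.integral_const, sub_zero, one_smul] at hI
  rw [caputoMean]
  have h0 : 0 ≤ (m : ℝ) ^ (-α) := by positivity
  calc _ ≤ (1 - α) * (m : ℝ) ^ (-α) := mul_le_mul_of_nonneg_left hI (by linarith)
    _ ≤ _ := by nlinarith

lemma caputoMean_eq {α : ℝ} (hα1 : α < 1) (m : ℕ) :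
    caputoMean α m = ((m : ℝ) + 1) ^ (1 - α) - (m : ℝ) ^ (1 - α) := by
  have h1 : 1 - α ≠ 0 := by linarith
  rw [caputoMean, intervalIntegral.integral_comp_add_left (fun x : ℝ => x ^ (-α)),
    integral_rpow (Or.inl (by linarith)), add_zero, show -α + 1 = 1 - α by ring]
  field_simp

lemma caputoMoment_eq {α : ℝ} (hα1 : α < 1) (m : ℕ) :
    caputoMoment α m = ((m : ℝ) + 1 / 2) * caputoMean α m -
      (1 - α) / (2 - α) * (((m : ℝ) + 1) ^ (2 - α) - (m : ℝ) ^ (2 - α)) := by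
  have hint := intervalIntegral.intervalIntegrable_rpow' (a := (m : ℝ)) (b := m + 1)
    (by linarith : -1 < -α)
  have hint' := intervalIntegral.intervalIntegrable_rpow' (a := (m : ℝ)) (b := m + 1)
    (by linarith : -1 < 1 - α)
  have e1 : ∫ t in (0 : ℝ)..1, ((m : ℝ) + t) ^ (-α) * (1 / 2 - t) =
      ∫ x in (m : ℝ)..(m + 1), (((m : ℝ) + 1 / 2) * x ^ (-α) - x ^ (1 - α)) := by
    have := intervalIntegral.integral_comp_add_left (a := 0) (b := 1)
      (fun x : ℝ => x ^ (-α) * ((m : ℝ) + 1 / 2 - x)) (m : ℝ)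
    rw [add_zero] at this
    calc _ = ∫ t in (0 : ℝ)..1, ((m : ℝ) + t) ^ (-α) * ((m : ℝ) + 1 / 2 - ((m : ℝ) + t)) := by
          refine intervalIntegral.integral_congr fun t _ => ?_
          ring
      _ = _ := this
      _ = _ := by
          refine intervalIntegral.integral_congr fun x hx => ?_
          have hx0 : 0 ≤ x := by
            rw [Set.uIcc_of_le (by linarith)] at hx
            exact (Nat.cast_nonneg m).trans hx.1
          have hp : x ^ (1 - α) = x * x ^ (-α) := by
            rw [sub_eq_add_neg, Real.rpow_add' hx0 (by linarith), Real.rpow_one]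
          simp only [hp]
          ring
  have e2 : caputoMean α m = (1 - α) * ∫ x in (m : ℝ)..(m + 1), x ^ (-α) := by
    rw [caputoMean, intervalIntegral.integral_comp_add_left (fun x : ℝ => x ^ (-α)), add_zero]
  rw [caputoMoment, e1, intervalIntegral.integral_sub (hint.const_mul _) hint',
    intervalIntegral.integral_const_mul, e2, integral_rpow (r := 1 - α) (Or.inl (by linarith)),
    show 1 - α + 1 = 2 - α by ring]
  ring

lemma two_rpow_one_sub (α : ℝ) : (2 : ℝ) ^ (1 - α) = 2 * 2 ^ (-α) := by
  rw [sub_eq_add_neg, Real.rpow_add (by norm_num), Real.rpow_one]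

lemma caputoMean_zero {α : ℝ} (hα1 : α < 1) : caputoMean α 0 = 1 := by
  rw [caputoMean_eq hα1]
  simp [Real.zero_rpow (by linarith : 1 - α ≠ 0)]

lemma caputoMean_one {α : ℝ} (hα1 : α < 1) : caputoMean α 1 = 2 * 2 ^ (-α) - 1 := by
  rw [caputoMean_eq hα1, ← two_rpow_one_sub]
  norm_num

lemma caputoMean_two {α : ℝ} (hα1 : α < 1) :
    caputoMean α 2 = 3 * 3 ^ (-α) - 2 * 2 ^ (-α) := by
  rw [caputoMean_eq hα1, ← two_rpow_one_sub, Nat.cast_ofNat,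
    show (2 : ℝ) + 1 = 3 by norm_num, sub_eq_add_neg 1 α, Real.rpow_add (by norm_num : (0:ℝ) < 3),
    Real.rpow_one]

lemma caputoMoment_zero_add_one {α : ℝ} (hα1 : α < 1) :
    caputoMoment α 0 + caputoMoment α 1 = 2 ^ (-α) * (2 + α) / (2 - α) - 1 := by
  have h2 : 2 - α ≠ 0 := by linarith
  have h4 : (2 : ℝ) ^ (2 - α) = 4 * 2 ^ (-α) := by
    rw [sub_eq_add_neg, Real.rpow_add (by norm_num)]; norm_num
  simp only [caputoMoment_eq hα1, caputoMean_zero hα1, caputoMean_one hα1, Nat.cast_zero,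
    Nat.cast_one, Real.zero_rpow h2, zero_add, Real.one_rpow, show (1 : ℝ) + 1 = 2 by norm_num, h4]
  field_simp
  ring

/-! ## Weights of the quadratic interpolation approximation -/

lemma eval_derivative_basis_three {a b c : ℕ} (hab : a ≠ b) (hac : a ≠ c) (hbc : b ≠ c) (s : ℝ) :
    (Polynomial.derivative (Lagrange.basis ({a, b, c} : Finset ℕ) (fun m : ℕ => (m : ℝ)) a)).eval s
      = (2 * s - b - c) / (((a : ℝ) - b) * (a - c)) := by
  have he : ({a, b, c} : Finset ℕ).erase a = {b, c} := by
    rw [Finset.erase_insert]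
    simp [hab, hac]
  have h1 : (a : ℝ) - b ≠ 0 := sub_ne_zero.mpr (by exact_mod_cast hab)
  have h2 : (a : ℝ) - c ≠ 0 := sub_ne_zero.mpr (by exact_mod_cast hac)
  rw [Lagrange.basis, he, Finset.prod_pair hbc]
  simp only [Lagrange.basisDivisor, Polynomial.derivative_mul, Polynomial.derivative_C,
    Polynomial.derivative_sub, Polynomial.derivative_X, Polynomial.eval_add, Polynomial.eval_mul,
    Polynomial.eval_sub, Polynomial.eval_C, Polynomial.eval_X, zero_mul, zero_add, sub_zero, mul_one]
  field_simp
  ring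

lemma qiaBasisDeriv_interior {n k : ℕ} (hn : 2 ≤ n) (hk : k + 2 ≤ n) (i : ℕ) (s : ℝ) :
    qiaBasisDeriv n k i s = ((if i = k + 1 then 1 else 0) - (if i = k then 1 else 0)) +
      ((if i = k + 2 then 1 else 0) - 2 * (if i = k + 1 then 1 else 0) +
        (if i = k then 1 else 0)) * (s - k - 1 / 2) := by
  have hnodes : qiaNodes n k = {k, k + 1, k + 2} := by
    rw [qiaNodes, if_neg (by omega), if_pos hk]
  rw [qiaBasisDeriv, hnodes]
  by_cases h0 : i = k
  · subst h0
    rw [if_pos (by simp), eval_derivative_basis_three (by omega) (by omega) (by omega)]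
    simp
    ring
  by_cases h1 : i = k + 1
  · subst h1
    rw [if_pos (by simp), Finset.insert_comm,
      eval_derivative_basis_three (by omega) (by omega) (by omega)]
    simp
    ring
  by_cases h2 : i = k + 2
  · subst h2
    rw [if_pos (by simp), show ({k, k + 1, k + 2} : Finset ℕ) = {k + 2, k, k + 1} by
      ext x; simp only [Finset.mem_insert, Finset.mem_singleton]; tauto,
      eval_derivative_basis_three (by omega) (by omega) (by omega)]
    simp
    ring
  · rw [if_neg (by simp [h0, h1, h2])]
    simp [h0, h1, h2]

lemma qiaBasisDeriv_last (k i : ℕ) (s : ℝ) :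
    qiaBasisDeriv (k + 2) (k + 1) i s =
      ((if i = k + 2 then 1 else 0) - (if i = k + 1 then 1 else 0)) +
      ((if i = k + 2 then 1 else 0) - 2 * (if i = k + 1 then 1 else 0) +
        (if i = k then 1 else 0)) * (s - (k + 1 : ℕ) - 1 / 2) := by
  have hnodes : qiaNodes (k + 2) (k + 1) = {k, k + 1, k + 2} := by
    rw [qiaNodes, if_neg (by omega), if_neg (by omega)]
    rfl
  rw [qiaBasisDeriv, hnodes]
  by_cases h0 : i = k
  · subst h0
    rw [if_pos (by simp), eval_derivative_basis_three (by omega) (by omega) (by omega)]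
    simp
    ring
  by_cases h1 : i = k + 1
  · subst h1
    rw [if_pos (by simp), Finset.insert_comm,
      eval_derivative_basis_three (by omega) (by omega) (by omega)]
    simp
    ring
  by_cases h2 : i = k + 2
  · subst h2
    rw [if_pos (by simp), show ({k, k + 1, k + 2} : Finset ℕ) = {k + 2, k, k + 1} by
      ext x; simp only [Finset.mem_insert, Finset.mem_singleton]; tauto,
      eval_derivative_basis_three (by omega) (by omega) (by omega)]
    simp
    ring
  · rw [if_neg (by simp [h0, h1, h2])]
    simp [h0, h1, h2]

lemma integral_rpow_mul_linear {α : ℝ} (hα1 : α < 1) {n k : ℕ} (hk : k < n) (p q : ℝ) :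
    ∫ s in (k : ℝ)..((k : ℝ) + 1), ((n : ℝ) - s) ^ (-α) * (p + q * (s - k - 1 / 2)) =
      (1 - α)⁻¹ * (p * caputoMean α (n - 1 - k) + q * caputoMoment α (n - 1 - k)) := by
  have h1 : 1 - α ≠ 0 := by linarith
  set m := n - 1 - k with hm
  have hmn : (n : ℝ) = m + 1 + k := by
    have : n = m + 1 + k := by omega
    exact_mod_cast this
  have hsub := intervalIntegral.integral_comp_sub_left (a := 0) (b := 1)
    (fun s : ℝ => ((n : ℝ) - s) ^ (-α) * (p + q * (s - k - 1 / 2))) ((k : ℝ) + 1)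
  rw [add_sub_cancel_right, sub_zero] at hsub
  rw [← hsub]
  have hI := intervalIntegrable_add_rpow_neg hα1 m
  calc _ = ∫ t in (0 : ℝ)..1, (((m : ℝ) + t) ^ (-α) * p +
        ((m : ℝ) + t) ^ (-α) * (1 / 2 - t) * q) := by
        refine intervalIntegral.integral_congr fun t _ => ?_
        rw [show (n : ℝ) - ((k : ℝ) + 1 - t) = m + t by rw [hmn]; ring]
        ring
    _ = _ := by
        rw [intervalIntegral.integral_add (hI.mul_const _) (hI.mul_half_sub.mul_const _),
          intervalIntegral.integral_mul_const, intervalIntegral.integral_mul_const, caputoMean,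
          caputoMoment]
        rw [mul_add, ← mul_assoc, ← mul_assoc, ← mul_assoc, ← mul_assoc, mul_right_comm _ p,
          mul_right_comm _ q, inv_mul_cancel₀ h1]
        ring

lemma qiaWeight_eq_sum {α : ℝ} (hα1 : α < 1) {n j : ℕ} (hn : 2 ≤ n) (hj : j ≤ n) :
    (1 - α) * Real.Gamma (1 - α) * qiaWeight α n j =
      ∑ m ∈ Finset.range n,
        (((if j = m then 1 else 0) - (if j = m + 1 then 1 else 0)) * caputoMean α m +
          (if m = 0 then (if j = 0 then 1 else 0) - 2 * (if j = 1 then 1 else 0) +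
              (if j = 2 then 1 else 0)
            else (if j + 1 = m then 1 else 0) - 2 * (if j = m then 1 else 0) +
              (if j = m + 1 then 1 else 0)) * caputoMoment α m) := by
  have hG : Real.Gamma (1 - α) ≠ 0 := (Real.Gamma_pos_of_pos (by linarith)).ne'
  have h1 : 1 - α ≠ 0 := by linarith
  rw [← Finset.sum_range_reflect, qiaWeight]
  rw [show ∀ S : ℝ, (1 - α) * Real.Gamma (1 - α) * (1 / Real.Gamma (1 - α) * S) = (1 - α) * S from
    fun S => by field_simp, Finset.mul_sum]
  refine Finset.sum_congr rfl fun k hk => ?_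
  have hkn : k < n := Finset.mem_range.mp hk
  by_cases hlast : k + 2 ≤ n
  · simp only [qiaBasisDeriv_interior hn hlast]
    have hz : n - 1 - k ≠ 0 := by omega
    rw [integral_rpow_mul_linear hα1 hkn, mul_inv_cancel_left₀ h1]
    simp only [if_neg hz, show (n - j = k + 1) ↔ (j = n - 1 - k) by omega,
      show (n - j = k) ↔ (j = n - 1 - k + 1) by omega,
      show (n - j = k + 2) ↔ (j + 1 = n - 1 - k) by omega]
  · obtain ⟨i, rfl⟩ : ∃ i, n = i + 2 := ⟨n - 2, by omega⟩
    obtain rfl : k = i + 1 := by omega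
    simp only [qiaBasisDeriv_last]
    rw [integral_rpow_mul_linear hα1 hkn, mul_inv_cancel_left₀ h1]
    simp only [if_true, show (i + 2 - j = i + 2) ↔ (j = 0) by omega,
      show (i + 2 - j = i + 1) ↔ (j = 1) by omega,
      show (i + 2 - j = i) ↔ (j = 2) by omega, show i + 2 - 1 - (i + 1) = 0 by omega, zero_add]

lemma qiaWeight_one {α : ℝ} (hα1 : α < 1) :
    (1 - α) * Real.Gamma (1 - α) * qiaWeight α 1 0 = 1 ∧
      (1 - α) * Real.Gamma (1 - α) * qiaWeight α 1 1 = -1 := by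
  have hG : Real.Gamma (1 - α) ≠ 0 := (Real.Gamma_pos_of_pos (by linarith)).ne'
  have h1 : 1 - α ≠ 0 := by linarith
  have hb1 : ∀ s, qiaBasisDeriv 1 0 1 s = 1 + 0 * (s - (0 : ℕ) - 1 / 2) := by
    intro s
    rw [qiaBasisDeriv, qiaNodes, if_pos rfl, if_pos (by simp), Finset.pair_comm,
      Lagrange.basis_pair_left _]
    · simp [Lagrange.basisDivisor]
    · simp
  have hb0 : ∀ s, qiaBasisDeriv 1 0 0 s = -1 + 0 * (s - (0 : ℕ) - 1 / 2) := by
    intro s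
    rw [qiaBasisDeriv, qiaNodes, if_pos rfl, if_pos (by simp), Lagrange.basis_pair_left _]
    · simp [Lagrange.basisDivisor]
    · simp
  constructor
  · have h := integral_rpow_mul_linear hα1 (Nat.zero_lt_one) 1 0
    simp only [← hb1] at h
    rw [qiaWeight, Finset.sum_range_one, h, Nat.sub_self, caputoMean_zero hα1]
    field_simp
    ring
  · have h := integral_rpow_mul_linear hα1 (Nat.zero_lt_one) (-1) 0
    simp only [← hb0] at h
    rw [qiaWeight, Finset.sum_range_one, h, Nat.sub_self, caputoMean_zero hα1]
    field_simp
    ring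

/-- The weights of the quadratic interpolation approximation away from the initial points,
multiplied by `(1 - α) Γ(1 - α)`. -/
def qiaCoeff (α : ℝ) : ℕ → ℝ
  | 0 => caputoMean α 0 + caputoMoment α 0 + caputoMoment α 1
  | 1 => caputoMean α 1 - caputoMean α 0 - 2 * caputoMoment α 0 - 2 * caputoMoment α 1 +
      caputoMoment α 2
  | 2 => caputoMean α 2 - caputoMean α 1 + caputoMoment α 0 + caputoMoment α 1 -
      2 * caputoMoment α 2 + caputoMoment α 3
  | j + 3 => caputoMean α (j + 3) - caputoMean α (j + 2) + caputoMoment α (j + 2) -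
      2 * caputoMoment α (j + 3) + caputoMoment α (j + 4)

lemma qiaWeight_eq_ite {α : ℝ} (hα1 : α < 1) {n j : ℕ} (hn : 1 ≤ n) (hj : j ≤ n + 1) :
    (1 - α) * Real.Gamma (1 - α) * qiaWeight α (n + 1) j =
      (if j ≤ n then caputoMean α j else 0) - (if 1 ≤ j then caputoMean α (j - 1) else 0) +
        (if j + 1 ≤ n then caputoMoment α (j + 1) else 0) -
        2 * (if 1 ≤ j ∧ j ≤ n then caputoMoment α j else 0) +
        (if 2 ≤ j then caputoMoment α (j - 1) else 0) +
        ((if j = 0 then 1 else 0) - 2 * (if j = 1 then 1 else 0) + (if j = 2 then 1 else 0)) *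
          caputoMoment α 0 := by
  rw [qiaWeight_eq_sum hα1 (by omega) hj, Finset.sum_range_succ']
  obtain rfl | rfl | rfl | ⟨i, rfl⟩ : j = 0 ∨ j = 1 ∨ j = 2 ∨ ∃ i, j = i + 3 := by
    rcases Nat.lt_or_ge j 3 with h | h
    · omega
    · exact Or.inr (Or.inr (Or.inr ⟨j - 3, by omega⟩))
  · simp [show 0 < n by omega, show 1 ≤ n by omega]
    ring
  · simp [Finset.sum_add_distrib, Finset.sum_sub_distrib, sub_mul, Nat.lt_iff_add_one_le]
    ring
  · simp [Finset.sum_add_distrib, Finset.sum_sub_distrib, add_mul, sub_mul, Nat.lt_iff_add_one_le,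
      hn]
    ring
  · have e1 : i + 1 < n := by omega
    have e2 : (i + 2 < n) ↔ (i + 3 ≤ n) := by omega
    have e3 : (i + 3 < n) ↔ (i + 4 ≤ n) := by omega
    simp [Finset.sum_add_distrib, Finset.sum_sub_distrib, add_mul, sub_mul, e1, e2, e3]
    ring

lemma qiaWeight_regular {α : ℝ} (hα1 : α < 1) {n j : ℕ} (hj : j + 2 ≤ n) :
    (1 - α) * Real.Gamma (1 - α) * qiaWeight α n j = qiaCoeff α j := by
  obtain ⟨m, rfl⟩ : ∃ m, n = m + 1 := ⟨n - 1, by omega⟩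
  rw [qiaWeight_eq_ite hα1 (by omega) (by omega)]
  obtain rfl | rfl | rfl | ⟨i, rfl⟩ : j = 0 ∨ j = 1 ∨ j = 2 ∨ ∃ i, j = i + 3 := by
    rcases Nat.lt_or_ge j 3 with h | h
    · omega
    · exact Or.inr (Or.inr (Or.inr ⟨j - 3, by omega⟩))
  · simp [qiaCoeff, show 1 ≤ m by omega]; ring
  · simp [qiaCoeff, show 1 ≤ m by omega, show 2 ≤ m by omega]; ring
  · simp [qiaCoeff, show 2 ≤ m by omega, show 3 ≤ m by omega]; ring
  · simp [qiaCoeff, show i + 3 ≤ m by omega, show i + 3 + 1 ≤ m by omega]; ring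

lemma qiaWeight_second_last {α : ℝ} (hα1 : α < 1) {n : ℕ} (hn : 1 ≤ n) :
    (1 - α) * Real.Gamma (1 - α) * qiaWeight α (n + 1) n =
      qiaCoeff α n - caputoMoment α (n + 1) := by
  rw [qiaWeight_eq_ite hα1 (by omega) (by omega)]
  obtain rfl | rfl | ⟨i, rfl⟩ : n = 1 ∨ n = 2 ∨ ∃ i, n = i + 3 := by
    rcases Nat.lt_or_ge n 3 with h | h
    · omega
    · exact Or.inr (Or.inr ⟨n - 3, by omega⟩)
  · simp [qiaCoeff]; ring
  · simp [qiaCoeff]; ring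
  · simp [qiaCoeff]; ring

lemma abs_qiaWeight_last_le {α : ℝ} (hα0 : 0 < α) (hα1 : α < 1) {n : ℕ} (hn : 1 ≤ n) :
    |(1 - α) * Real.Gamma (1 - α) * qiaWeight α (n + 1) (n + 1)| ≤ 2 * (n : ℝ) ^ (-α) := by
  rw [qiaWeight_eq_ite hα1 (by omega) (by omega)]
  have hAn := caputoMean_nonneg hα1 n
  have hBn := caputoMoment_nonneg hα0 hα1 n
  have hBA := caputoMoment_le hα1 n
  have hA := caputoMean_le hα0 hα1 n hn
  rcases Nat.eq_or_lt_of_le hn with h | h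
  · subst h
    have hB0 := caputoMoment_nonneg hα0 hα1 0
    have hB0' := caputoMoment_le hα1 0
    rw [caputoMean_zero hα1] at hB0'
    simp at hA ⊢
    rw [abs_le]
    constructor <;> linarith
  · simp [show n ≠ 0 by omega, show n ≠ 1 by omega, hn]
    rw [abs_le]
    constructor <;> linarith

lemma natCast_rpow_neg_le {p : ℝ} (hp0 : 0 ≤ p) {n k c : ℕ} (hc : 1 ≤ c)
    (hk : k ≤ c * n) : (n : ℝ) ^ (-p) ≤ (c : ℝ) ^ p * (k : ℝ) ^ (-p) ∨ k = 0 := by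
  rcases Nat.eq_zero_or_pos k with h | h
  · exact Or.inr h
  left
  have hk0 : (0 : ℝ) < k := by exact_mod_cast h
  have hc0 : (0 : ℝ) < c := by exact_mod_cast hc
  calc (n : ℝ) ^ (-p) ≤ ((k : ℝ) / c) ^ (-p) :=
        Real.rpow_le_rpow_of_nonpos (by positivity)
          (by rw [div_le_iff₀ hc0, mul_comm]; exact_mod_cast hk) (by linarith)
    _ = (c : ℝ) ^ p * (k : ℝ) ^ (-p) := by
        rw [Real.div_rpow hk0.le hc0.le, Real.rpow_neg hc0.le, div_inv_eq_mul, mul_comm]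

lemma exists_isAsymptoticKernel_qia {α : ℝ} (hα0 : 0 < α) (hα1 : α < 1) :
    ∃ K : ℝ, IsAsymptoticKernel
      (fun n j => (1 - α) * Real.Gamma (1 - α) * qiaWeight α n j) (qiaCoeff α) α K := by
  obtain ⟨h10, h11⟩ := qiaWeight_one hα1
  refine ⟨2 * 2 ^ α, ?_, ?_, fun n j hj => qiaWeight_regular hα1 hj, fun n hn => ?_,
    fun n hn => ?_⟩
  · rw [h10]; norm_num
  · rw [h10, h11]
  · obtain ⟨m, rfl⟩ : ∃ m, n = m + 1 := ⟨n - 1, by omega⟩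
    rw [Nat.add_sub_cancel, qiaWeight_second_last hα1 (by omega), sub_sub_cancel_left, abs_neg,
      abs_of_nonneg (caputoMoment_nonneg hα0 hα1 _)]
    have h1 := caputoMoment_le hα1 (m + 1)
    have h2 := caputoMean_le hα0 hα1 (m + 1) (by omega)
    have h3 := caputoMean_nonneg hα1 (m + 1)
    have h4 : (1 : ℝ) ≤ 2 ^ α := Real.one_le_rpow one_le_two hα0.le
    have h5 : 0 ≤ ((m + 1 : ℕ) : ℝ) ^ (-α) := by positivity
    nlinarith
  · obtain ⟨m, rfl⟩ : ∃ m, n = m + 1 := ⟨n - 1, by omega⟩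
    have h1 := abs_qiaWeight_last_le hα0 hα1 (n := m) (by omega)
    have h2 := (natCast_rpow_neg_le hα0.le (n := m) (k := m + 1) (c := 2) (by norm_num)
      (by omega)).resolve_right (by omega)
    rw [Nat.cast_ofNat] at h2
    linarith

lemma qiaCoeff_nonpos {α : ℝ} (hα0 : 0 < α) (hα1 : α < 1) (j : ℕ) (hj : 3 ≤ j) :
    qiaCoeff α j ≤ 0 := by
  obtain ⟨i, rfl⟩ : ∃ i, j = i + 3 := ⟨j - 3, by omega⟩
  have h1 := caputoMoment_sub_succ_le hα0 hα1 (i + 2)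
  have h2 := caputoMoment_succ_le hα0 hα1 (i + 3)
  have h3 := caputoMean_succ_le hα0 hα1 (i + 2)
  simp only [qiaCoeff, show i + 2 + 1 = i + 3 from rfl, show i + 3 + 1 = i + 4 from rfl] at *
  linarith

lemma sum_qiaCoeff (α : ℝ) (n : ℕ) : ∑ j ∈ Finset.range (n + 3), qiaCoeff α j =
    caputoMean α (n + 2) + caputoMoment α (n + 3) - caputoMoment α (n + 2) := by
  induction n with
  | zero => simp only [Finset.sum_range_succ, Finset.sum_range_zero, qiaCoeff]; ring
  | succ n ih =>
    rw [show n + 1 + 3 = n + 3 + 1 by ring, Finset.sum_range_succ, ih]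
    simp only [qiaCoeff, show n + 1 + 2 = n + 3 by ring, show n + 3 + 1 = n + 4 by ring]
    ring

lemma sum_qiaCoeff_nonneg {α : ℝ} (hα0 : 0 < α) (hα1 : α < 1) (n : ℕ) (hn : 2 ≤ n) :
    0 ≤ ∑ j ∈ Finset.range (n + 1), qiaCoeff α j := by
  obtain ⟨m, rfl⟩ : ∃ m, n = m + 2 := ⟨n - 2, by omega⟩
  rw [sum_qiaCoeff]
  have h1 := caputoMoment_le hα1 (m + 2)
  have h2 := caputoMean_nonneg hα1 (m + 2)
  have h3 := caputoMoment_nonneg hα0 hα1 (m + 3)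
  linarith

lemma exists_abs_qiaCoeff_le {α : ℝ} (hα0 : 0 < α) (hα1 : α < 1) :
    ∃ K : ℝ, ∀ j : ℕ, |qiaCoeff α j| ≤ K * ((j : ℝ) + 1) ^ (-(1 + α)) := by
  refine exists_forall_abs_le_of_tail (J := 3) (K := 2 * 2 ^ (1 + α)) fun j hj => ?_
  rw [abs_of_nonpos (qiaCoeff_nonpos hα0 hα1 j hj)]
  obtain ⟨i, rfl⟩ : ∃ i, j = i + 3 := ⟨j - 3, by omega⟩
  have h1 := caputoMoment_sub_succ_le hα0 hα1 (i + 3)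
  have h2 := caputoMoment_succ_le hα0 hα1 (i + 2)
  have h3 := caputoMean_sub_succ_le hα0 hα1 (i + 2) (by omega)
  have h4 := caputoMean_sub_succ_le hα0 hα1 (i + 3) (by omega)
  have h5 : ((i + 3 : ℕ) : ℝ) ^ (-(1 + α)) ≤ ((i + 2 : ℕ) : ℝ) ^ (-(1 + α)) :=
    Real.rpow_le_rpow_of_nonpos (by positivity) (by push_cast; linarith) (by linarith)
  have h6 := (natCast_rpow_neg_le (by linarith : 0 ≤ 1 + α) (n := i + 2) (k := i + 3 + 1) (c := 2)
    (by norm_num) (by omega)).resolve_right (by omega)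
  have h7 : 0 ≤ ((i + 3 : ℕ) : ℝ) ^ (-(1 + α)) := by positivity
  simp only [qiaCoeff, show i + 2 + 1 = i + 3 from rfl, show i + 3 + 1 = i + 4 from rfl] at *
  push_cast at *
  rw [show (i : ℝ) + 3 + 1 = i + 4 by ring]
  linarith

lemma quadratic_interpolation_margin {α s : ℝ} (hα0 : 1 / 8 ≤ α) (hα1 : α < 1) (hs0 : 0 ≤ s)
    (hs : s ≤ α / 2) : s * (1 + s) ≤ 2 * ((α * (3 - α) / 2 + s) ^ 2 - s ^ 2) := by
  have h9 : 0 ≤ s * (α / 2 - s) := mul_nonneg hs0 (by linarith)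
  have h10 : s * (1 + α / 2 - 2 * α * (3 - α)) ≤ α ^ 2 * (3 - α) ^ 2 / 2 := by
    rcases le_total (1 + α / 2 - 2 * α * (3 - α)) 0 with h | h
    · exact (mul_nonpos_of_nonneg_of_nonpos hs0 h).trans (by positivity)
    · refine (mul_le_mul_of_nonneg_right hs h).trans ?_
      have h11 : 1 + α / 2 - 2 * α * (3 - α) ≤ α * (3 - α) ^ 2 := by
        nlinarith [mul_nonneg (by linarith : 0 ≤ α - 1 / 8) (by linarith : 0 ≤ 1 - α),
          mul_nonneg (mul_nonneg (by linarith : 0 ≤ α - 1 / 8) (by linarith : 0 ≤ 1 - α))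
            (by linarith : 0 ≤ 1 - α)]
      have := mul_le_mul_of_nonneg_left h11 (by linarith : 0 ≤ α / 2)
      linarith
  linarith

theorem forcedDecay_qia {α H b : ℝ} (hα0 : 0 < α) (hα1 : α < 1) (hH : 0 < H) (hb : 0 < b)
    (hcond : 2 * qiaWeight α 4 2 ≤ H * b) : ForcedDecay (qiaWeight α) α 5 H b := by
  have hG : 0 < Real.Gamma (1 - α) := Real.Gamma_pos_of_pos (by linarith)
  set M : ℝ := (1 - α) * Real.Gamma (1 - α) with hM
  have hM0 : 0 < M := mul_pos (by linarith) hG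
  refine ForcedDecay.of_scaled M⁻¹ ?_
  rw [inv_inv]
  obtain ⟨K, hw⟩ := exists_isAsymptoticKernel_qia hα0 hα1
  obtain ⟨K', hK'⟩ := exists_abs_qiaCoeff_le hα0 hα1
  have hsum := sum_qiaCoeff_nonneg hα0 hα1
  have hneg := qiaCoeff_nonpos hα0 hα1
  have hH' : 0 < M * H := by positivity
  have hB : 2 * qiaCoeff α 2 ≤ M * H * b := by
    rw [← qiaWeight_regular hα1 (by norm_num : 2 + 2 ≤ 4), ← hM]
    have := mul_le_mul_of_nonneg_left hcond hM0.le
    linarith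
  have hB0 : 0 < M * H * b := by positivity
  set B : ℝ := M * H * b with hBdef
  have hA0 := caputoMean_zero hα1
  have hA1 := caputoMean_one hα1
  have hA2 := caputoMean_two hα1
  have hA10 := caputoMean_succ_le hα0 hα1 0
  have hs := caputoMoment_zero_add_one hα1
  have hb0 := caputoMoment_nonneg hα0 hα1 0
  have hb1 := caputoMoment_nonneg hα0 hα1 1
  have hb2 := caputoMoment_nonneg hα0 hα1 2
  have hb21 := caputoMoment_succ_le hα0 hα1 1
  have hb32 := caputoMoment_succ_le hα0 hα1 2
  have e0 : qiaCoeff α 0 = caputoMean α 0 + caputoMoment α 0 + caputoMoment α 1 := rfl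
  have e1 : qiaCoeff α 1 = caputoMean α 1 - caputoMean α 0 - 2 * caputoMoment α 0 -
    2 * caputoMoment α 1 + caputoMoment α 2 := rfl
  have e2 : qiaCoeff α 2 = caputoMean α 2 - caputoMean α 1 + caputoMoment α 0 +
    caputoMoment α 1 - 2 * caputoMoment α 2 + caputoMoment α 3 := rfl
  simp only [show 1 + 1 = 2 from rfl, show 2 + 1 = 3 from rfl, zero_add] at hA10 hb21 hb32
  rcases le_or_gt (qiaCoeff α 2) 0 with h2 | h2
  · refine forcedDecay_of_nonpos hα0 hα1 hH' hb hw (fun j hj => ?_) (fun n => ?_) hK'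
    · rcases Nat.lt_or_ge j 3 with h | h
      · interval_cases j
        · linarith
        · exact h2
      · exact hneg j h
    · rcases Nat.lt_or_ge n 2 with hn | hn
      · have hW := hsum 2 le_rfl
        simp only [Finset.sum_range_succ, Finset.sum_range_zero] at hW
        interval_cases n
        · simp only [Finset.sum_range_succ, Finset.sum_range_zero]
          linarith
        · simp only [Finset.sum_range_succ, Finset.sum_range_zero]
          linarith
      · exact hsum n hn
  set y : ℝ := 2 ^ (-α) with hy
  set s : ℝ := caputoMoment α 0 + caputoMoment α 1 with hsdef
  set ρ : ℝ := (2 / 3 : ℝ) ^ α with hρ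
  have hy0 : 0 < y := by positivity
  have hz : (3 : ℝ) ^ (-α) = ρ * y := by
    rw [hρ, hy, Real.div_rpow (by norm_num) (by norm_num), Real.rpow_neg (by norm_num),
      Real.rpow_neg (by norm_num)]
    field_simp
  have hy1 : y ≤ 1 - α / 2 := by
    have h := rpow_one_add_le_one_add_mul_self (s := -(1 / 2)) (by norm_num) hα0.le hα1.le
    have h' : y = (1 + -(1 / 2)) ^ α := by
      rw [hy, Real.rpow_neg (by norm_num), ← Real.inv_rpow (by norm_num)]; norm_num
    rw [h']
    linarith
  have hρ1 : ρ ≤ 1 - α / 3 := by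
    have h := rpow_one_add_le_one_add_mul_self (s := -(1 / 3)) (by norm_num) hα0.le hα1.le
    rw [show (1 : ℝ) + -(1 / 3) = 2 / 3 by norm_num] at h
    linarith
  have h2α : 0 < 2 - α := by linarith
  have hs' : (s + 1) * (2 - α) = y * (2 + α) := by rw [hs]; field_simp; ring
  have hs0 : 0 ≤ s := by positivity
  rcases le_or_gt α (1 / 8) with hα8 | hα8
  · exfalso
    have hρ2 : ρ ≤ 1 - 48 / 1000 * (8 * α) := by
      have h := rpow_one_add_le_one_add_mul_self (s := -(48 / 1000)) (by norm_num)
        (by linarith : 0 ≤ 8 * α) (by linarith)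
      have h' : ρ ≤ (1 + -(48 / 1000)) ^ (8 * α) := by
        rw [Real.rpow_mul (by norm_num)]
        refine Real.rpow_le_rpow (by norm_num) ?_ hα0.le
        norm_num
      linarith
    have h3 : (s + 1) * (2 - α) ≤ y * (4 - 3 * ρ) * (2 - α) := by
      rw [hs', mul_assoc]
      refine mul_le_mul_of_nonneg_left ?_ hy0.le
      nlinarith
    have h4 := le_of_mul_le_mul_right h3 h2α
    rw [hz] at hA2
    linarith
  · have hsα : s ≤ α / 2 := by
      have h3 : (s + 1) * (2 - α) ≤ (α / 2 + 1) * (2 - α) := by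
        rw [hs']
        have := mul_le_mul_of_nonneg_right hy1 (by linarith : 0 ≤ 2 + α)
        linarith
      linarith [le_of_mul_le_mul_right h3 h2α]
    have hA2' : caputoMean α 2 ≤ 1 - α * (3 - α) / 2 := by
      have h3 := mul_le_mul_of_nonneg_left (by linarith : 3 * ρ - 2 ≤ 1 - α) hy0.le
      have h4 := mul_le_mul_of_nonneg_right hy1 (by linarith : 0 ≤ 1 - α)
      rw [hA2, hz]
      linarith
    have hω2 : qiaCoeff α 2 ≤ s := by
      have := caputoMean_succ_le hα0 hα1 1
      simp only [show 1 + 1 = 2 from rfl] at this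
      linarith
    have hT : α * (3 - α) / 2 + s ≤ -(qiaCoeff α 1 + qiaCoeff α 2) := by linarith
    set T : ℝ := -(qiaCoeff α 1 + qiaCoeff α 2) with hTdef
    have ht0 : α ≤ α * (3 - α) / 2 := by nlinarith
    have hω0 : qiaCoeff α 0 = 1 + s := by rw [e0, hA0]; ring
    refine forcedDecay_of_shiftedKernel hα0 hα1 hH' hb hw (by linarith) h2
      (by rw [max_eq_right (hneg 3 le_rfl)]; linarith) (fun j hj => hneg j (by omega)) hsum ?_ hK'
    rw [← hBdef, hω0, show (qiaCoeff α 1 + qiaCoeff α 2) ^ 2 = T ^ 2 by rw [hTdef]; ring]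
    set v : ℝ := qiaCoeff α 2 with hv
    have hTs : (α * (3 - α) / 2 + s) ^ 2 ≤ T ^ 2 := pow_le_pow_left₀ (by linarith) hT 2
    have hvs : v ^ 2 ≤ s ^ 2 := pow_le_pow_left₀ h2.le hω2 2
    have hpoly := quadratic_interpolation_margin hα8.le hα1 hs0 hsα
    have h7 : v * (1 + s) ≤ 2 * (T ^ 2 - v ^ 2) := by
      have : v * (1 + s) ≤ s * (1 + s) := mul_le_mul_of_nonneg_right hω2 (by linarith)
      linarith
    have h8 : 0 ≤ T ^ 2 - v ^ 2 := by
      have := mul_nonneg (mul_nonneg hα0.le (by linarith : 0 ≤ 3 - α)) hs0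
      linarith [sq_nonneg (α * (3 - α) / 2)]
    have h9 := mul_le_mul_of_nonneg_left h7 h2.le
    have h10 := mul_le_mul_of_nonneg_right hB h8
    linarith

end

theorem theorem3p3 (α : ℝ) (hα0 : 0 < α) (hα1 : α < 1) :
    ∃ c : ℝ, 0 < c ∧
      -- (i) contractivity, second order F-BDF
      (∀ h lam : ℝ, 0 < h → lam < 0 →
        h ^ α * lam ≤ -2 * bdf2Weight α 2 - 2 * bdf2Weight α 3 →
        SchemeContractive (bdf2SchemeWeight α) α c h lam) ∧
      -- (i) contractivity, quadratic interpolation approximation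
      (∀ h lam : ℝ, 0 < h → lam < 0 →
        (∀ n : ℕ, 4 ≤ n → h ^ α * lam ≤ -2 * qiaWeight α n 2) →
        SchemeContractive (qiaWeight α) α c h lam) ∧
      -- (ii) dissipativity, second order F-BDF
      (∀ h a b : ℝ, 0 < h → 0 ≤ a → 0 < b →
        2 * bdf2Weight α 2 + 2 * bdf2Weight α 3 ≤ h ^ α * b →
        SchemeDissipative (bdf2SchemeWeight α) α c h a b ∧
          (a = 0 → SchemeDecay (bdf2SchemeWeight α) α c h b)) ∧
      -- (ii) dissipativity, quadratic interpolation approximation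
      (∀ h a b : ℝ, 0 < h → 0 ≤ a → 0 < b →
        (∀ n : ℕ, 4 ≤ n → 2 * qiaWeight α n 2 ≤ h ^ α * b) →
        SchemeDissipative (qiaWeight α) α c h a b ∧
          (a = 0 → SchemeDecay (qiaWeight α) α c h b)) := by
  refine ⟨5, by norm_num, fun h lam hh hlam hc => ?_, fun h lam hh hlam hc => ?_,
    fun h a b hh ha hb hc => ?_, fun h a b hh ha hb hc => ?_⟩
  · exact (forcedDecay_bdf2 hα0 hα1 (Real.rpow_pos_of_pos hh α) (neg_pos.mpr hlam)
      (by linarith)).schemeContractive (by norm_num) hh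
  · have := hc 4 le_rfl
    exact (forcedDecay_qia hα0 hα1 (Real.rpow_pos_of_pos hh α) (neg_pos.mpr hlam)
      (by linarith)).schemeContractive (by norm_num) hh
  · have hd := forcedDecay_bdf2 hα0 hα1 (Real.rpow_pos_of_pos hh α) hb hc
    exact ⟨hd.schemeDissipative hα0 (by norm_num) hh ha hb, fun _ => hd.schemeDecay (by norm_num) hh⟩
  · have hd := forcedDecay_qia hα0 hα1 (Real.rpow_pos_of_pos hh α) hb (hc 4 le_rfl)
    exact ⟨hd.schemeDissipative hα0 (by norm_num) hh ha hb, fun _ => hd.schemeDecay (by norm_num) hh⟩
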